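/- Let $X=(X^1,\dots,X^N)$ be an integrable random vector on a probability space, whose components $X^i$ are real-valued or, more generally, take values in finite-dimensional real inner product spaces, and let $W$ be a standard Gaussian random vector of the same dimension as $X$ (zero mean, identity covariance), independent of $X$. For $t>0$ put $X_t=X+\sqrt{2t}\,W$, with components $X_t^i$. Let $\mathcal T(X)\in[0,\infty]$ be the total correlation of $X$, that is, the Kullback–Leibler divergence $\mathrm{KL}\big(P_X\,\big\|\,P_{X^1}\otimes\cdots\otimes P_{X^N}\big)$ of the joint law of $X$ from the product of its marginal laws, which is $\int p(x)\log\frac{p(x)}{\prod_{i=1}^N p(x^i)}\,dx$ when $X$ has a density $p(x)=p(x^1,\dots,x^N)$ with marginal densities $p(x^i)$. Then $$\mathcal T(X)=\int_0^\infty \frac{1}{4t^2}\,\mathbb E\Big\|\,\mathbb E[X\mid X_t]-\big[\mathbb E[X^i\mid X^i_t]\big]_{i=1}^N\Big\|^2\,dt ,$$ where $[\,\cdot^i\,]_{i=1}^N$ denotes the concatenation of $N$ components into one vector and $\|\cdot\|$ is the Euclidean norm; the identity holds in $[0,\infty]$, both sides being infinite simultaneously. -/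

import Mathlib

open MeasureTheory ProbabilityTheory InformationTheory
open scoped ENNReal

/-- The Gaussian-noised version `X_t = X + √(2t) W` of a random vector `X`. -/
noncomputable def noised {Ω F : Type*} [AddCommGroup F] [Module ℝ F]
    (X W : Ω → F) (t : ℝ) : Ω → F :=
  fun ω => X ω + Real.sqrt (2 * t) • W ω

/-- The total correlation of `X = (X¹, …, X^N)`: the Kullback-Leibler divergence, with values in
`[0, ∞]`, of the joint law of the components from the product of their marginal laws. -/
noncomputable def totalCorrelation {Ω : Type*} [MeasurableSpace Ω] {N : ℕ} {E : Fin N → Type*}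
    [∀ i, MeasurableSpace (E i)] (μ : Measure Ω) (X : Ω → PiLp 2 E) : ℝ≥0∞ :=
  klDiv (μ.map (fun ω i => X ω i)) (Measure.pi (fun i => μ.map (fun ω => X ω i)))

/-- The joint denoiser `E[X | X_t]`, where `Y = X_t`. -/
noncomputable def jointDenoiser {Ω : Type*} [MeasurableSpace Ω] {N : ℕ} {E : Fin N → Type*}
    [∀ i, NormedAddCommGroup (E i)] [∀ i, InnerProductSpace ℝ (E i)]
    [∀ i, FiniteDimensional ℝ (E i)] [∀ i, MeasurableSpace (E i)]
    (μ : Measure Ω) (X Y : Ω → PiLp 2 E) : Ω → PiLp 2 E :=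
  μ[X | MeasurableSpace.comap Y inferInstance]

/-- The concatenation `[E[Xⁱ | Xⁱ_t]]ᵢ` of the marginal denoisers, where `Y = X_t`. -/
noncomputable def marginalDenoisers {Ω : Type*} [MeasurableSpace Ω] {N : ℕ} {E : Fin N → Type*}
    [∀ i, NormedAddCommGroup (E i)] [∀ i, InnerProductSpace ℝ (E i)]
    [∀ i, FiniteDimensional ℝ (E i)] [∀ i, MeasurableSpace (E i)]
    (μ : Measure Ω) (X Y : Ω → PiLp 2 E) : Ω → PiLp 2 E :=
  fun ω => WithLp.toLp 2 (fun i =>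
    (μ[(fun ω' => X ω' i) | MeasurableSpace.comap (fun ω' => Y ω' i) inferInstance]) ω)

/-! Put s = (2t)^(-1/2) and observe Y = s X + W, a rescaling of X_t; neither the total correlation
nor the generated σ-algebras change. Relative to `gaussRef`, Y has density m_s(z) = E exp(-‖z -
sX‖²/2), and its total correlation is E log m_s(Y) minus the same quantities for the components
(`klDiv_observation`).

Differentiate log m_s(sx + w) in t with x and w held fixed (`hasDerivAt_log_noisyDensity`). Bayes'
formula (`condExp_comp_noise`) turns the expected derivative into (E‖W‖² - E‖E[W|Y]‖²)/(2t). The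
terms E‖W‖² cancel between the joint channel and the components, leaving -(E‖V‖² - E‖U‖²)/(2t),
where V = E[W|Y] and U concatenates the E[W^i|Y^i]. As U is a function of Y, E⟨U,V⟩ = E⟨U,W⟩ =
E‖U‖², so the bracket is E‖V - U‖² (`integral_norm_sq_sub_marginalNoiseEstimate`). Tweedie's formula
E[X|X_t] = X_t - √(2t) V (`condExp_signal_noised`) identifies the result with the integrand.

Integrating over (a, ∞) gives the identity for X_a, provided the log-likelihood gap vanishes as t →
∞. With only a first moment available, this follows from Gibbs' inequality against a weight with
Huber tails (`tendsto_integral_logLikelihood`). As a → 0, data processing gives T(X_a) ≤ T(X), and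
lower semicontinuity (`klDiv_le_of_tendsto`), from the variational formula for the divergence, gives
the other inequality, whether or not T(X) is finite. -/

set_option linter.unusedSectionVars false

/-! ### Gaussian kernel and its reference measure -/

section GaussianReference

variable {F : Type*} [NormedAddCommGroup F]

/-- The unnormalised standard Gaussian density. -/
noncomputable def gaussKernel (z : F) : ℝ := Real.exp (-‖z‖ ^ 2 / 2)

theorem gaussKernel_pos (z : F) : 0 < gaussKernel z := Real.exp_pos _

theorem gaussKernel_le_one (z : F) : gaussKernel z ≤ 1 := by
  rw [gaussKernel, Real.exp_le_one_iff]
  have := sq_nonneg ‖z‖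
  linarith

theorem continuous_gaussKernel : Continuous (gaussKernel : F → ℝ) := by
  unfold gaussKernel; fun_prop

theorem measurable_ofReal_gaussKernel [MeasurableSpace F] [BorelSpace F] :
    Measurable (fun z : F => ENNReal.ofReal (gaussKernel z)) :=
  continuous_gaussKernel.measurable.ennreal_ofReal

variable [InnerProductSpace ℝ F] [FiniteDimensional ℝ F] [MeasurableSpace F] [BorelSpace F]

theorem integral_gaussKernel :
    ∫ z : F, gaussKernel z = (Real.pi / (1 / 2)) ^ (Module.finrank ℝ F / 2 : ℝ) := by
  rw [← GaussianFourier.integral_rexp_neg_mul_sq_norm (V := F) (b := 1 / 2) (by norm_num)]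
  refine integral_congr_ae (.of_forall fun z => ?_)
  simp only [gaussKernel]
  congr 1
  ring

theorem integrable_gaussKernel : Integrable (gaussKernel : F → ℝ) := by
  by_contra h
  have h1 := integral_gaussKernel (F := F)
  rw [integral_undef h] at h1
  have : (0 : ℝ) < (Real.pi / (1 / 2)) ^ (Module.finrank ℝ F / 2 : ℝ) := by positivity
  linarith

/-- The two measures have the same Fourier transform. The value of the constant never matters
afterwards, only its sign. -/
theorem exists_stdGaussian_eq_withDensity (F : Type*) [NormedAddCommGroup F]
    [InnerProductSpace ℝ F] [FiniteDimensional ℝ F] [MeasurableSpace F] [BorelSpace F] :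
    ∃ c : ℝ, 0 < c ∧
      stdGaussian F = volume.withDensity (fun z => ENNReal.ofReal (c * gaussKernel z)) := by
  have hpos : (0 : ℝ) < (Real.pi / (1 / 2)) ^ (Module.finrank ℝ F / 2 : ℝ) := by positivity
  refine ⟨((Real.pi / (1 / 2)) ^ (Module.finrank ℝ F / 2 : ℝ))⁻¹, by positivity, ?_⟩
  set c := ((Real.pi / (1 / 2)) ^ (Module.finrank ℝ F / 2 : ℝ))⁻¹ with hc
  have hc0 : 0 < c := by positivity
  have hint : Integrable (fun z : F => c * gaussKernel z) := integrable_gaussKernel.const_mul c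
  have : IsFiniteMeasure
      ((volume : Measure F).withDensity (fun z => ENNReal.ofReal (c * gaussKernel z))) :=
    isFiniteMeasure_withDensity_ofReal hint.2
  refine Measure.ext_of_charFun (funext fun t => ?_)
  have hmeas : Measurable (fun z : F => ENNReal.ofReal (c * gaussKernel z)) :=
    (continuous_const.mul continuous_gaussKernel).measurable.ennreal_ofReal
  rw [charFun_stdGaussian, charFun_apply,
    integral_withDensity_eq_integral_toReal_smul hmeas (.of_forall fun _ => ENNReal.ofReal_lt_top)]
  have h := GaussianFourier.integral_cexp_neg_mul_sq_norm_add (V := F) (b := 1 / 2)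
    (by norm_num) Complex.I t
  have h2 : ∀ z : F, (ENNReal.ofReal (c * gaussKernel z)).toReal •
      Complex.exp (inner ℝ z t * Complex.I) =
      (c : ℂ) * Complex.exp (-(1 / 2) * ‖z‖ ^ 2 + Complex.I * inner ℝ t z) := fun z => by
    rw [ENNReal.toReal_ofReal (mul_nonneg hc0.le (gaussKernel_pos z).le), gaussKernel,
      Complex.real_smul]
    push_cast
    rw [mul_assoc, ← Complex.exp_add, real_inner_comm]
    congr 2
    ring
  simp_rw [h2]
  rw [integral_const_mul, h]
  have h3 : ((c : ℂ)) * ((Real.pi : ℂ) / (1 / 2)) ^ (Module.finrank ℝ F / 2 : ℂ) = 1 := by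
    have : ((Real.pi : ℂ) / (1 / 2)) ^ (Module.finrank ℝ F / 2 : ℂ) = ((c⁻¹ : ℝ) : ℂ) := by
      rw [hc, inv_inv, Complex.ofReal_cpow (by positivity)]
      push_cast
      rfl
    rw [this, ← Complex.ofReal_mul, mul_inv_cancel₀ hc0.ne', Complex.ofReal_one]
  rw [← mul_assoc, h3, one_mul]
  congr 1
  rw [Complex.I_sq]
  ring

/-- The translation invariant measure with respect to which the standard Gaussian measure has
density `gaussKernel`. -/
noncomputable def gaussRef (F : Type*) [NormedAddCommGroup F]
    [InnerProductSpace ℝ F] [FiniteDimensional ℝ F] [MeasurableSpace F] : Measure F :=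
  (stdGaussian F).withDensity fun z => ENNReal.ofReal (gaussKernel z)⁻¹

/-- The kernel cancels its inverse and only the normalising constant survives; σ-finiteness,
translation invariance and integrability criteria then come from `volume`. -/
theorem exists_gaussRef_eq_smul_volume (F : Type*) [NormedAddCommGroup F]
    [InnerProductSpace ℝ F] [FiniteDimensional ℝ F] [MeasurableSpace F] [BorelSpace F] :
    ∃ c : ℝ, 0 < c ∧ gaussRef F = ENNReal.ofReal c • volume := by
  obtain ⟨c, hc, h⟩ := exists_stdGaussian_eq_withDensity F
  refine ⟨c, hc, ?_⟩
  have hm : Measurable (fun z : F => ENNReal.ofReal (c * gaussKernel z)) :=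
    (continuous_const.mul continuous_gaussKernel).measurable.ennreal_ofReal
  have hm' : Measurable (fun z : F => ENNReal.ofReal (gaussKernel z)⁻¹) :=
    continuous_gaussKernel.measurable.inv.ennreal_ofReal
  rw [gaussRef, h, ← withDensity_mul _ hm hm', ← withDensity_const]
  congr 1
  funext z
  have := gaussKernel_pos z
  rw [Pi.mul_apply, ← ENNReal.ofReal_mul (by positivity)]
  congr 1
  field_simp

instance : SigmaFinite (gaussRef F) := by
  obtain ⟨c, hc, h⟩ := exists_gaussRef_eq_smul_volume F
  rw [h]
  have : SigmaFinite (c.toNNReal • (volume : Measure F)) := inferInstance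
  exact this

instance : (gaussRef F).IsAddLeftInvariant := by
  obtain ⟨c, hc, h⟩ := exists_gaussRef_eq_smul_volume F
  rw [h]
  infer_instance

theorem gaussRef_withDensity_gaussKernel :
    (gaussRef F).withDensity (fun z => ENNReal.ofReal (gaussKernel z)) = stdGaussian F := by
  have hm' : Measurable (fun z : F => ENNReal.ofReal (gaussKernel z)⁻¹) :=
    continuous_gaussKernel.measurable.inv.ennreal_ofReal
  rw [gaussRef, ← withDensity_mul _ hm' measurable_ofReal_gaussKernel]
  have : (fun z : F => ENNReal.ofReal (gaussKernel z)⁻¹) *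
      (fun z => ENNReal.ofReal (gaussKernel z)) = 1 := by
    funext z
    have := gaussKernel_pos z
    rw [Pi.mul_apply, ← ENNReal.ofReal_mul (by positivity), inv_mul_cancel₀ this.ne']
    simp
  rw [this, withDensity_one]

/-- Substitution z = x + w, by translation invariance of `gaussRef`. -/
theorem lintegral_add_stdGaussian {f : F → ℝ≥0∞} (hf : Measurable f) (x : F) :
    ∫⁻ w, f (x + w) ∂stdGaussian F =
      ∫⁻ z, ENNReal.ofReal (gaussKernel (z - x)) * f z ∂gaussRef F := by
  rw [← gaussRef_withDensity_gaussKernel,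
    lintegral_withDensity_eq_lintegral_mul _ measurable_ofReal_gaussKernel (by fun_prop)]
  conv_rhs => rw [← lintegral_add_left_eq_self _ x]
  simp

/-- The joint law of a signal `x` and of its noisy observation `s • x + w`. -/
theorem map_prod_stdGaussian (P : Measure F) [IsProbabilityMeasure P] (s : ℝ) :
    (P.prod (stdGaussian F)).map (fun p => (p.1, s • p.1 + p.2)) =
      (P.prod (gaussRef F)).withDensity
        (fun p => ENNReal.ofReal (gaussKernel (p.2 - s • p.1))) := by
  have hk : Measurable (fun p : F × F => ENNReal.ofReal (gaussKernel (p.2 - s • p.1))) :=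
    measurable_ofReal_gaussKernel.comp (by fun_prop)
  refine Measure.ext_of_lintegral _ fun f hf => ?_
  rw [lintegral_map hf (by fun_prop), lintegral_withDensity_eq_lintegral_mul _ hk hf,
    lintegral_prod _ (by fun_prop), lintegral_prod _ (by fun_prop)]
  refine lintegral_congr fun x => ?_
  exact lintegral_add_stdGaussian (f := fun z => f (x, z)) (by fun_prop) (s • x)

end GaussianReference

/-! ### Density of the observation and Bayes' formula -/

section Posterior

variable {F : Type*} [NormedAddCommGroup F] [InnerProductSpace ℝ F] [FiniteDimensional ℝ F]
  [MeasurableSpace F] [BorelSpace F]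
  {G : Type*} [NormedAddCommGroup G] [NormedSpace ℝ G]

/-- The density, with respect to `gaussRef`, of `s • X + W` where `X` has law `P` and `W` is an
independent standard Gaussian vector. -/
noncomputable def noisyDensity (P : Measure F) (s : ℝ) (z : F) : ℝ :=
  ∫ y, gaussKernel (z - s • y) ∂P

/-- The posterior mean of `h W` given `s • X + W = z`, where `X` has law `P` and `W` is an
independent standard Gaussian vector. -/
noncomputable def posteriorMean (P : Measure F) (s : ℝ) (h : F → G) (z : F) : G :=
  (noisyDensity P s z)⁻¹ • ∫ y, gaussKernel (z - s • y) • h (z - s • y) ∂P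

theorem integrable_gaussKernel_sub (P : Measure F) [IsFiniteMeasure P] (s : ℝ) (z : F) :
    Integrable (fun y => gaussKernel (z - s • y)) P := by
  refine Integrable.of_bound (C := 1) ?_ (.of_forall fun y => ?_)
  · exact (continuous_gaussKernel.comp (by fun_prop)).aestronglyMeasurable
  · rw [Real.norm_of_nonneg (gaussKernel_pos _).le]
    exact gaussKernel_le_one _

theorem noisyDensity_pos (P : Measure F) [IsProbabilityMeasure P] (s : ℝ) (z : F) :
    0 < noisyDensity P s z := by
  refine (integral_pos_iff_support_of_nonneg (fun y => (gaussKernel_pos _).le)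
    (integrable_gaussKernel_sub P s z)).2 ?_
  have : Function.support (fun y => gaussKernel (z - s • y)) = Set.univ :=
    Set.eq_univ_of_forall fun y => (gaussKernel_pos _).ne'
  simp [this]

/-- With `gaussRef` as reference, log-likelihoods are nonpositive, so integrability needs a bound on
one side only. -/
theorem noisyDensity_le_one (P : Measure F) [IsProbabilityMeasure P] (s : ℝ) (z : F) :
    noisyDensity P s z ≤ 1 := by
  calc noisyDensity P s z ≤ ∫ _, (1 : ℝ) ∂P :=
        integral_mono (integrable_gaussKernel_sub P s z) (integrable_const _)
          fun y => gaussKernel_le_one _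
    _ = 1 := by simp

/-- Measurability jointly in (s, z) is what Fubini in time and ω will require. -/
theorem stronglyMeasurable_integral_gaussKernel_smul (P : Measure F) [IsFiniteMeasure P]
    {h : F → G} (hh : Continuous h) :
    StronglyMeasurable
      (fun p : ℝ × F => ∫ y, gaussKernel (p.2 - p.1 • y) • h (p.2 - p.1 • y) ∂P) := by
  have hc : Continuous (fun q : (ℝ × F) × F =>
      gaussKernel (q.1.2 - q.1.1 • q.2) • h (q.1.2 - q.1.1 • q.2)) :=
    (continuous_gaussKernel.comp (by fun_prop)).smul (hh.comp (by fun_prop))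
  exact hc.stronglyMeasurable.integral_prod_right'

theorem measurable_noisyDensity_uncurry (P : Measure F) [IsFiniteMeasure P] :
    Measurable (fun p : ℝ × F => noisyDensity P p.1 p.2) := by
  have := (stronglyMeasurable_integral_gaussKernel_smul P
    (continuous_const (y := (1 : ℝ)))).measurable
  simpa [noisyDensity] using this

theorem measurable_noisyDensity (P : Measure F) [IsFiniteMeasure P] (s : ℝ) :
    Measurable (noisyDensity P s) :=
  (measurable_noisyDensity_uncurry P).comp (g := fun p : ℝ × F => noisyDensity P p.1 p.2)
    (f := fun z : F => (s, z)) (by fun_prop)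

theorem stronglyMeasurable_posteriorMean_uncurry (P : Measure F) [IsFiniteMeasure P]
    {h : F → G} (hh : Continuous h) :
    StronglyMeasurable (fun p : ℝ × F => posteriorMean P p.1 h p.2) :=
  (measurable_noisyDensity_uncurry P).inv.stronglyMeasurable.smul
    (stronglyMeasurable_integral_gaussKernel_smul P hh)

theorem stronglyMeasurable_posteriorMean (P : Measure F) [IsFiniteMeasure P] (s : ℝ)
    {h : F → G} (hh : Continuous h) : StronglyMeasurable (posteriorMean P s h) :=
  (stronglyMeasurable_posteriorMean_uncurry P hh).comp_measurable
    (g := fun z : F => (s, z)) (by fun_prop)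

theorem measurable_ofReal_gaussKernel_sub (s : ℝ) :
    Measurable (fun p : F × F => ENNReal.ofReal (gaussKernel (p.2 - s • p.1))) :=
  measurable_ofReal_gaussKernel.comp (by fun_prop)

variable {Ω : Type*} [MeasurableSpace Ω] {μ : Measure Ω} [IsProbabilityMeasure μ] {X W : Ω → F}

theorem map_signal_observation (hX : Measurable X) (hW : Measurable W)
    (hWlaw : μ.map W = stdGaussian F) (hXW : IndepFun X W μ) (s : ℝ) :
    μ.map (fun ω => (X ω, s • X ω + W ω)) = ((μ.map X).prod (gaussRef F)).withDensity
        (fun p => ENNReal.ofReal (gaussKernel (p.2 - s • p.1))) := by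
  have := Measure.isProbabilityMeasure_map hX.aemeasurable (μ := μ)
  rw [← map_prod_stdGaussian, ← hWlaw,
    ← (indepFun_iff_map_prod_eq_prod_map_map hX.aemeasurable hW.aemeasurable).1 hXW,
    Measure.map_map (by fun_prop) (by fun_prop)]
  rfl

theorem map_observation (hX : Measurable X) (hW : Measurable W)
    (hWlaw : μ.map W = stdGaussian F) (hXW : IndepFun X W μ) (s : ℝ) :
    μ.map (fun ω => s • X ω + W ω) =
      (gaussRef F).withDensity (fun z => ENNReal.ofReal (noisyDensity (μ.map X) s z)) := by
  have := Measure.isProbabilityMeasure_map hX.aemeasurable (μ := μ)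
  have h1 : μ.map (fun ω => s • X ω + W ω) =
      (μ.map (fun ω => (X ω, s • X ω + W ω))).map Prod.snd := by
    rw [Measure.map_map (by fun_prop) (by fun_prop)]; rfl
  have hk := measurable_ofReal_gaussKernel_sub (F := F) s
  refine Measure.ext_of_lintegral _ fun f hf => ?_
  rw [h1, map_signal_observation hX hW hWlaw hXW, lintegral_map hf measurable_snd,
    lintegral_withDensity_eq_lintegral_mul _ hk (by fun_prop),
    lintegral_prod_symm _ (by fun_prop), lintegral_withDensity_eq_lintegral_mul _
      (measurable_noisyDensity _ s).ennreal_ofReal hf]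
  refine lintegral_congr fun z => ?_
  simp only [Pi.mul_apply]
  have hz : Measurable (fun x => ENNReal.ofReal (gaussKernel (z - s • x))) :=
    measurable_ofReal_gaussKernel.comp (by fun_prop)
  rw [lintegral_mul_const _ hz, noisyDensity, ofReal_integral_eq_lintegral_ofReal
    (integrable_gaussKernel_sub _ s z) (.of_forall fun _ => (gaussKernel_pos _).le)]

/-- Since W = Y - sX, the noise is a function of the pair (X, Y), whose density is explicit.
Integrating out X shows that both sides have the same integral over {Y ∈ A}. The cases needed are h
= `id` and h = ‖·‖². -/
theorem condExp_comp_noise [CompleteSpace G] (hX : Measurable X) (hW : Measurable W)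
    (hWlaw : μ.map W = stdGaussian F) (hXW : IndepFun X W μ) (s : ℝ)
    {h : F → G} (hh : Continuous h) (hhint : Integrable (fun ω => h (W ω)) μ) :
    μ[fun ω => h (W ω) | MeasurableSpace.comap (fun ω => s • X ω + W ω) inferInstance] =ᵐ[μ]
      fun ω => posteriorMean (μ.map X) s h (s • X ω + W ω) := by
  have := Measure.isProbabilityMeasure_map hX.aemeasurable (μ := μ)
  set P := μ.map X with hP
  have hY : Measurable (fun ω => s • X ω + W ω) := by fun_prop
  have hk := measurable_ofReal_gaussKernel_sub (F := F) s
  have hkr : ∀ p : F × F, (ENNReal.ofReal (gaussKernel (p.2 - s • p.1))).toReal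
      = gaussKernel (p.2 - s • p.1) := fun p => ENNReal.toReal_ofReal (gaussKernel_pos _).le
  have hmr : ∀ z, (ENNReal.ofReal (noisyDensity P s z)).toReal = noisyDensity P s z :=
    fun z => ENNReal.toReal_ofReal (noisyDensity_pos P s z).le
  have hφ : Continuous (fun p : F × F => h (p.2 - s • p.1)) := hh.comp (by fun_prop)
  have hint : Integrable (fun p : F × F => gaussKernel (p.2 - s • p.1) • h (p.2 - s • p.1))
      (P.prod (gaussRef F)) := by
    have h1 : Integrable (fun p : F × F => h (p.2 - s • p.1))
        (μ.map (fun ω => (X ω, s • X ω + W ω))) := by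
      rw [integrable_map_measure hφ.aestronglyMeasurable (by fun_prop)]
      simpa [Function.comp_def] using hhint
    rw [map_signal_observation hX hW hWlaw hXW, integrable_withDensity_iff_integrable_smul' hk
      (.of_forall fun _ => ENNReal.ofReal_lt_top)] at h1
    simpa only [hkr] using h1
  have hsm := stronglyMeasurable_posteriorMean P s hh
  have hmul : ∀ z, noisyDensity P s z • posteriorMean P s h z =
      ∫ y, gaussKernel (z - s • y) • h (z - s • y) ∂P := fun z => by
    rw [posteriorMean, smul_smul, mul_inv_cancel₀ (noisyDensity_pos P s z).ne', one_smul]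
  have hint2 : Integrable (posteriorMean P s h) (μ.map (fun ω => s • X ω + W ω)) := by
    rw [map_observation hX hW hWlaw hXW, integrable_withDensity_iff_integrable_smul'
      (measurable_noisyDensity P s).ennreal_ofReal (.of_forall fun _ => ENNReal.ofReal_lt_top)]
    simp only [hmr, hmul]
    exact hint.integral_prod_right
  have hint3 : Integrable (fun ω => posteriorMean P s h (s • X ω + W ω)) μ :=
    hint2.comp_measurable hY
  refine (ae_eq_condExp_of_forall_setIntegral_eq hY.comap_le hhint
    (fun _ _ _ => hint3.integrableOn) ?_ ?_).symm
  · rintro _ ⟨A, hA, rfl⟩ -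
    have e1 : ∫ ω in (fun ω => s • X ω + W ω) ⁻¹' A, h (W ω) ∂μ =
        ∫ z in A, noisyDensity P s z • posteriorMean P s h z ∂gaussRef F := by
      have : ∫ ω in (fun ω => s • X ω + W ω) ⁻¹' A, h (W ω) ∂μ =
          ∫ p in Set.univ ×ˢ A, h (p.2 - s • p.1) ∂(μ.map (fun ω => (X ω, s • X ω + W ω))) := by
        rw [setIntegral_map (MeasurableSet.univ.prod hA) hφ.aestronglyMeasurable (by fun_prop)]
        simp [Set.mk_preimage_prod]
      rw [this, map_signal_observation hX hW hWlaw hXW,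
        restrict_withDensity (MeasurableSet.univ.prod hA),
        integral_withDensity_eq_integral_toReal_smul hk
          (.of_forall fun _ => ENNReal.ofReal_lt_top)]
      simp only [hkr]
      rw [← Measure.prod_restrict, Measure.restrict_univ, integral_prod_symm]
      · simp only [hmul]; rfl
      · have := hint.integrableOn (s := Set.univ ×ˢ A)
        rwa [IntegrableOn, ← Measure.prod_restrict, Measure.restrict_univ] at this
    have e2 : ∫ ω in (fun ω => s • X ω + W ω) ⁻¹' A, posteriorMean P s h (s • X ω + W ω) ∂μ =
        ∫ z in A, noisyDensity P s z • posteriorMean P s h z ∂gaussRef F := by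
      rw [← setIntegral_map hA hsm.aestronglyMeasurable hY.aemeasurable,
        map_observation hX hW hWlaw hXW, restrict_withDensity hA,
        integral_withDensity_eq_integral_toReal_smul
          (measurable_noisyDensity P s).ennreal_ofReal (.of_forall fun _ => ENNReal.ofReal_lt_top)]
      simp only [hmr]
    rw [e1, e2]
  · refine StronglyMeasurable.aestronglyMeasurable ?_
    exact hsm.comp_measurable (comap_measurable _)

end Posterior

/-! ### Differentiating the log-likelihood in time -/

section Derivative

variable {F : Type*} [NormedAddCommGroup F]

/-- This is a e^(-a) ≤ 1 with a = ‖u‖²/2. Such bounds dominate derivatives without any moment of the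
signal. -/
theorem gaussKernel_mul_norm_sq_le (u : F) : gaussKernel u * ‖u‖ ^ 2 ≤ 2 := by
  have h := Real.add_one_le_exp (‖u‖ ^ 2 / 2)
  have h1 : gaussKernel u * Real.exp (‖u‖ ^ 2 / 2) = 1 := by
    rw [gaussKernel, ← Real.exp_add]; simp [neg_div]
  nlinarith [gaussKernel_pos u]

theorem gaussKernel_mul_norm_le (u : F) : gaussKernel u * ‖u‖ ≤ 2 := by
  have h := gaussKernel_mul_norm_sq_le u
  nlinarith [gaussKernel_pos u, gaussKernel_le_one u, sq_nonneg (‖u‖ - 1)]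

variable [InnerProductSpace ℝ F] [FiniteDimensional ℝ F]
  [MeasurableSpace F] [BorelSpace F]

theorem integrable_gaussKernel_mul_norm_sq (P : Measure F) [IsFiniteMeasure P] (s : ℝ) (z : F) :
    Integrable (fun y => gaussKernel (z - s • y) * ‖z - s • y‖ ^ 2) P := by
  refine Integrable.of_bound (C := 2) ?_ (.of_forall fun y => ?_)
  · exact ((continuous_gaussKernel.comp (by fun_prop)).mul (by fun_prop)).aestronglyMeasurable
  · rw [Real.norm_of_nonneg (mul_nonneg (gaussKernel_pos _).le (by positivity))]
    exact gaussKernel_mul_norm_sq_le _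

theorem integrable_gaussKernel_smul_id (P : Measure F) [IsFiniteMeasure P] (s : ℝ) (z : F) :
    Integrable (fun y => gaussKernel (z - s • y) • (z - s • y)) P := by
  refine Integrable.of_bound (C := 2) ?_ (.of_forall fun y => ?_)
  · exact ((continuous_gaussKernel.comp (by fun_prop)).smul (by fun_prop)).aestronglyMeasurable
  · rw [norm_smul, Real.norm_of_nonneg (gaussKernel_pos _).le]
    exact gaussKernel_mul_norm_le _

theorem hasDerivAt_gaussKernel_path (x w y : F) (s : ℝ) :
    HasDerivAt (fun s : ℝ => gaussKernel (s • x + w - s • y))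
      (-(gaussKernel (s • x + w - s • y) * inner ℝ (s • x + w - s • y) (x - y))) s := by
  have h1 : HasDerivAt (fun s : ℝ => s • x + w - s • y) (x - y) s := by
    have h := (((hasDerivAt_id s).smul_const x).add_const w).sub ((hasDerivAt_id s).smul_const y)
    simp only [one_smul] at h
    exact h
  have h2 := (h1.norm_sq.neg.div_const 2).exp
  simp only [gaussKernel]
  refine h2.congr_deriv ?_
  simp only [Pi.neg_apply]
  ring

/-- Dominated differentiation. With u = rx + w - ry one has x - y = r⁻¹(u - w), so growth in y is
growth in u and the kernel absorbs it. The ball of radius s/2 keeps r⁻¹ below (s/2)⁻¹. -/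
theorem hasDerivAt_noisyDensity_path (P : Measure F) [IsProbabilityMeasure P] (x w : F) {s : ℝ}
    (hs : 0 < s) :
    HasDerivAt (fun s => noisyDensity P s (s • x + w))
      (∫ y, -(gaussKernel (s • x + w - s • y) * inner ℝ (s • x + w - s • y) (x - y)) ∂P) s := by
  have hcont : ∀ r : ℝ, Continuous (fun y => gaussKernel (r • x + w - r • y)) := fun r =>
    continuous_gaussKernel.comp (by fun_prop)
  refine (hasDerivAt_integral_of_dominated_loc_of_deriv_le
    (bound := fun _ => (s / 2)⁻¹ * (2 + 2 * ‖w‖)) (s := Metric.ball s (s / 2))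
    (F := fun r y => gaussKernel (r • x + w - r • y))
    (F' := fun r y => -(gaussKernel (r • x + w - r • y) * inner ℝ (r • x + w - r • y) (x - y)))
    (Metric.ball_mem_nhds s (by positivity))
    (.of_forall fun r => (hcont r).aestronglyMeasurable)
    (integrable_gaussKernel_sub P s (s • x + w)) ?_ ?_ (integrable_const _) ?_).2
  · exact (((hcont s).mul (by fun_prop)).neg).aestronglyMeasurable
  · refine .of_forall fun y r hr => ?_
    have hr2 : s / 2 < r := by
      rw [Metric.mem_ball, Real.dist_eq, abs_lt] at hr
      linarith
    have hr0 : 0 < r := by linarith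
    set u := r • x + w - r • y with hu
    have hxy : x - y = r⁻¹ • (u - w) := by
      rw [hu, eq_inv_smul_iff₀ hr0.ne', smul_sub]; abel
    rw [norm_neg, Real.norm_eq_abs, abs_mul, abs_of_pos (gaussKernel_pos u), hxy,
      inner_smul_right, abs_mul, abs_of_pos (inv_pos.2 hr0)]
    have h1 : |inner ℝ u (u - w)| ≤ ‖u‖ * (‖u‖ + ‖w‖) :=
      (abs_real_inner_le_norm _ _).trans
        (mul_le_mul_of_nonneg_left (norm_sub_le _ _) (norm_nonneg _))
    have h2 : gaussKernel u * |inner ℝ u (u - w)| ≤ 2 + 2 * ‖w‖ := by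
      have h3 := mul_le_mul_of_nonneg_left h1 (gaussKernel_pos u).le
      nlinarith [gaussKernel_mul_norm_sq_le u,
        mul_le_mul_of_nonneg_right (gaussKernel_mul_norm_le u) (norm_nonneg w)]
    calc gaussKernel u * (r⁻¹ * |inner ℝ u (u - w)|)
        = r⁻¹ * (gaussKernel u * |inner ℝ u (u - w)|) := by ring
      _ ≤ (s / 2)⁻¹ * (2 + 2 * ‖w‖) := by
        gcongr
        exact mul_nonneg (gaussKernel_pos u).le (abs_nonneg _)
  · exact .of_forall fun y r _ => hasDerivAt_gaussKernel_path x w y r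

/-- The reciprocal of the noise level at time `t`. -/
noncomputable def invNoise (t : ℝ) : ℝ := (Real.sqrt (2 * t))⁻¹

theorem invNoise_pos {t : ℝ} (ht : 0 < t) : 0 < invNoise t := by
  unfold invNoise; positivity

theorem measurable_invNoise : Measurable invNoise := by
  unfold invNoise; fun_prop

theorem hasDerivAt_invNoise {t : ℝ} (ht : 0 < t) :
    HasDerivAt invNoise (-(invNoise t * (2 * t)⁻¹)) t := by
  have h0 : (0 : ℝ) < 2 * t := by positivity
  have h := (((hasDerivAt_id t).const_mul 2).sqrt h0.ne').inv (Real.sqrt_pos.2 h0).ne'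
  refine h.congr_deriv ?_
  have h1 : 0 < Real.sqrt (2 * t) := Real.sqrt_pos.2 h0
  simp only [invNoise, id]
  have h2 : Real.sqrt (2 * t) ^ 2 = 2 * t := Real.sq_sqrt h0.le
  rw [h2]
  field_simp

/-- Since ds/dt = -s/(2t) and x - y = s⁻¹((z - sy) - w), the factors s cancel. Moving along sx + w
with x, w fixed produces only posterior means: no second derivative of the density, hence no
integration by parts. -/
theorem hasDerivAt_log_noisyDensity (P : Measure F) [IsProbabilityMeasure P] (x w : F) {t : ℝ}
    (ht : 0 < t) :
    HasDerivAt (fun t => Real.log (noisyDensity P (invNoise t) (invNoise t • x + w)))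
      ((2 * t)⁻¹ * (posteriorMean P (invNoise t) (fun u => ‖u‖ ^ 2) (invNoise t • x + w)
        - inner ℝ (posteriorMean P (invNoise t) id (invNoise t • x + w)) w)) t := by
  have hs := invNoise_pos ht
  have h1 := (hasDerivAt_noisyDensity_path P x w hs).comp t (hasDerivAt_invNoise ht)
  have h2 := h1.log (noisyDensity_pos P _ _).ne'
  refine h2.congr_deriv ?_
  simp only [Function.comp]
  set s := invNoise t with hs'
  set z := s • x + w with hz
  have h3 : ∀ y, -(gaussKernel (z - s • y) * inner ℝ (z - s • y) (x - y)) =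
      -s⁻¹ * (gaussKernel (z - s • y) * ‖z - s • y‖ ^ 2
        - inner ℝ w (gaussKernel (z - s • y) • (z - s • y))) := fun y => by
    have hxy : x - y = s⁻¹ • ((z - s • y) - w) := by
      rw [hz, eq_inv_smul_iff₀ hs.ne', smul_sub]; abel
    rw [hxy, inner_smul_right, inner_sub_right, real_inner_self_eq_norm_sq, inner_smul_right,
      real_inner_comm w]
    ring
  simp_rw [h3]
  rw [integral_const_mul, integral_sub (integrable_gaussKernel_mul_norm_sq P s z)
    ((integrable_gaussKernel_smul_id P s z).const_inner w),
    integral_inner (integrable_gaussKernel_smul_id P s z), posteriorMean, posteriorMean,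
    inner_smul_left, real_inner_comm w]
  have hm := noisyDensity_pos P s z
  have ht0 : t ≠ 0 := ht.ne'
  simp only [smul_eq_mul, id, RCLike.conj_to_real]
  field_simp

end Derivative

/-! ### Evolution of the expected log-likelihood -/

section Evolution

variable {F : Type*} [NormedAddCommGroup F] [InnerProductSpace ℝ F] [FiniteDimensional ℝ F]
  [MeasurableSpace F] [BorelSpace F]
  {Ω : Type*} [MeasurableSpace Ω] {μ : Measure Ω} [IsProbabilityMeasure μ] {X W : Ω → F}

theorem MeasureTheory.MemLp.integrable_inner {U V : Ω → F} (hU : MemLp U 2 μ)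
    (hV : MemLp V 2 μ) : Integrable (fun ω => inner ℝ (U ω) (V ω)) μ := by
  refine (hU.norm.integrable_mul hV.norm).mono'
    (hU.aestronglyMeasurable.inner hV.aestronglyMeasurable) (.of_forall fun ω => ?_)
  exact norm_inner_le_norm _ _

/-- The log-density of the observation `s • X + W`, evaluated at the observation. -/
noncomputable def logLikelihood (μ : Measure Ω) (X W : Ω → F) (s : ℝ) (ω : Ω) : ℝ :=
  Real.log (noisyDensity (μ.map X) s (s • X ω + W ω))

/-- The second moment of the posterior mean of the noise `W` given `s • X + W`. -/
noncomputable def noiseEstimateEnergy (μ : Measure Ω) (X W : Ω → F) (s : ℝ) : ℝ :=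
  ∫ ω, ‖posteriorMean (μ.map X) s id (s • X ω + W ω)‖ ^ 2 ∂μ

theorem memLp_two_noise (hW : Measurable W) (hWlaw : μ.map W = stdGaussian F) : MemLp W 2 μ := by
  have h := IsGaussian.memLp_two_id (μ := stdGaussian F)
  rw [← hWlaw] at h
  exact h.comp_of_map hW.aemeasurable

theorem integral_norm_sq_noise (hW : Measurable W) (hWlaw : μ.map W = stdGaussian F) :
    ∫ ω, ‖W ω‖ ^ 2 ∂μ = ∫ w, ‖w‖ ^ 2 ∂stdGaussian F := by
  rw [← hWlaw, integral_map hW.aemeasurable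
    (by fun_prop : Continuous fun w : F => ‖w‖ ^ 2).aestronglyMeasurable]

theorem memLp_two_posteriorMean (hX : Measurable X) (hW : Measurable W)
    (hWlaw : μ.map W = stdGaussian F) (hXW : IndepFun X W μ) (s : ℝ) :
    MemLp (fun ω => posteriorMean (μ.map X) s id (s • X ω + W ω)) 2 μ := by
  have hL := memLp_two_noise hW hWlaw
  exact (memLp_congr_ae (condExp_comp_noise hX hW hWlaw hXW s continuous_id
    (hL.integrable one_le_two))).1 (hL.condExp one_le_two)

/-- Conditional expectation is an orthogonal projection: against a function of the observation, W
may be replaced by its posterior mean. -/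
theorem integral_inner_noise_of_comap (hX : Measurable X) (hW : Measurable W)
    (hWlaw : μ.map W = stdGaussian F) (hXW : IndepFun X W μ) (s : ℝ) {U : Ω → F}
    (hU : StronglyMeasurable[MeasurableSpace.comap (fun ω => s • X ω + W ω) inferInstance] U)
    (hU2 : MemLp U 2 μ) :
    ∫ ω, inner ℝ (U ω) (W ω) ∂μ =
      ∫ ω, inner ℝ (U ω) (posteriorMean (μ.map X) s id (s • X ω + W ω)) ∂μ := by
  have hL := memLp_two_noise hW hWlaw
  have hY : Measurable (fun ω => s • X ω + W ω) := by fun_prop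
  have hint : Integrable (fun ω => inner ℝ (U ω) (W ω)) μ := hU2.integrable_inner hL
  have h1 := condExp_bilin_of_stronglyMeasurable_left (innerSL ℝ (E := F)) hU
    hint (hL.integrable one_le_two)
  rw [← integral_condExp hY.comap_le]
  refine integral_congr_ae ?_
  filter_upwards [h1, condExp_comp_noise hX hW hWlaw hXW s continuous_id
    (hL.integrable one_le_two)] with ω h2 h3
  rw [← h3]
  exact h2

theorem stronglyMeasurable_comap_posteriorMean (hX : Measurable X) (s : ℝ) :
    StronglyMeasurable[MeasurableSpace.comap (fun ω => s • X ω + W ω) inferInstance]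
      (fun ω => posteriorMean (μ.map X) s id (s • X ω + W ω)) := by
  have := Measure.isProbabilityMeasure_map hX.aemeasurable (μ := μ)
  exact (stronglyMeasurable_posteriorMean (μ.map X) s continuous_id).comp_measurable
    (comap_measurable _)

theorem integral_inner_posteriorMean_noise (hX : Measurable X) (hW : Measurable W)
    (hWlaw : μ.map W = stdGaussian F) (hXW : IndepFun X W μ) (s : ℝ) :
    ∫ ω, inner ℝ (posteriorMean (μ.map X) s id (s • X ω + W ω)) (W ω) ∂μ =
      noiseEstimateEnergy μ X W s := by
  rw [integral_inner_noise_of_comap hX hW hWlaw hXW s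
    (stronglyMeasurable_comap_posteriorMean hX s) (memLp_two_posteriorMean hX hW hWlaw hXW s)]
  simp only [real_inner_self_eq_norm_sq, noiseEstimateEnergy]

theorem integral_abs_inner_le (hX : Measurable X) (hW : Measurable W)
    (hWlaw : μ.map W = stdGaussian F) (hXW : IndepFun X W μ) (s : ℝ) :
    ∫ ω, |inner ℝ (posteriorMean (μ.map X) s id (s • X ω + W ω)) (W ω)| ∂μ ≤
      (noiseEstimateEnergy μ X W s + ∫ w, ‖w‖ ^ 2 ∂stdGaussian F) / 2 := by
  have hL := memLp_two_noise hW hWlaw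
  have hV := memLp_two_posteriorMean hX hW hWlaw hXW s
  rw [← integral_norm_sq_noise hW hWlaw, noiseEstimateEnergy,
    ← integral_add (hV.integrable_norm_pow two_ne_zero) (hL.integrable_norm_pow two_ne_zero),
    ← integral_div]
  refine integral_mono (hV.integrable_inner hL).abs
    (((hV.integrable_norm_pow two_ne_zero).add (hL.integrable_norm_pow two_ne_zero)).div_const 2)
    fun ω => ?_
  have h1 := abs_real_inner_le_norm (posteriorMean (μ.map X) s id (s • X ω + W ω)) (W ω)
  have h2 := sq_nonneg (‖posteriorMean (μ.map X) s id (s • X ω + W ω)‖ - ‖W ω‖)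
  linarith

/-- With e the energy and d = E‖W‖², e = E⟨V, W⟩ ≤ (e + d)/2, hence e ≤ d. -/
theorem noiseEstimateEnergy_le (hX : Measurable X) (hW : Measurable W)
    (hWlaw : μ.map W = stdGaussian F) (hXW : IndepFun X W μ) (s : ℝ) :
    noiseEstimateEnergy μ X W s ≤ ∫ w, ‖w‖ ^ 2 ∂stdGaussian F := by
  have h1 := integral_abs_inner_le hX hW hWlaw hXW s
  have h2 := integral_inner_posteriorMean_noise hX hW hWlaw hXW s
  have h3 := (le_abs_self _).trans (abs_integral_le_integral_abs (μ := μ)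
    (f := fun ω => inner ℝ (posteriorMean (μ.map X) s id (s • X ω + W ω)) (W ω)))
  linarith

theorem integrable_posteriorMean_norm_sq (hX : Measurable X) (hW : Measurable W)
    (hWlaw : μ.map W = stdGaussian F) (hXW : IndepFun X W μ) (s : ℝ) :
    Integrable (fun ω => posteriorMean (μ.map X) s (fun u => ‖u‖ ^ 2) (s • X ω + W ω)) μ :=
  integrable_condExp.congr (condExp_comp_noise hX hW hWlaw hXW s (h := fun u => ‖u‖ ^ 2)
    (by fun_prop) ((memLp_two_noise hW hWlaw).integrable_norm_pow two_ne_zero))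

theorem integral_posteriorMean_norm_sq (hX : Measurable X) (hW : Measurable W)
    (hWlaw : μ.map W = stdGaussian F) (hXW : IndepFun X W μ) (s : ℝ) :
    ∫ ω, posteriorMean (μ.map X) s (fun u => ‖u‖ ^ 2) (s • X ω + W ω) ∂μ =
      ∫ w, ‖w‖ ^ 2 ∂stdGaussian F := by
  have hY : Measurable (fun ω => s • X ω + W ω) := by fun_prop
  rw [← integral_norm_sq_noise hW hWlaw, ← integral_condExp hY.comap_le (f := fun ω => ‖W ω‖ ^ 2)]
  exact integral_congr_ae (condExp_comp_noise hX hW hWlaw hXW s (h := fun u => ‖u‖ ^ 2)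
    (by fun_prop) ((memLp_two_noise hW hWlaw).integrable_norm_pow two_ne_zero)).symm

theorem posteriorMean_norm_sq_nonneg (P : Measure F) [IsProbabilityMeasure P] (s : ℝ) (z : F) :
    0 ≤ posteriorMean P s (fun u => ‖u‖ ^ 2) z :=
  smul_nonneg (inv_nonneg.2 (noisyDensity_pos P s z).le)
    (integral_nonneg fun _ => smul_nonneg (gaussKernel_pos _).le (by positivity))

/-- The time derivative of the log-likelihood of the observation. -/
noncomputable def logLikelihoodRate (μ : Measure Ω) (X W : Ω → F) (t : ℝ) (ω : Ω) : ℝ :=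
  (2 * t)⁻¹ * (posteriorMean (μ.map X) (invNoise t) (fun u => ‖u‖ ^ 2) (invNoise t • X ω + W ω)
    - inner ℝ (posteriorMean (μ.map X) (invNoise t) id (invNoise t • X ω + W ω)) (W ω))

theorem hasDerivAt_logLikelihood (hX : Measurable X) (ω : Ω) {t : ℝ} (ht : 0 < t) :
    HasDerivAt (fun t => logLikelihood μ X W (invNoise t) ω) (logLikelihoodRate μ X W t ω) t := by
  have := Measure.isProbabilityMeasure_map hX.aemeasurable (μ := μ)
  exact hasDerivAt_log_noisyDensity (μ.map X) (X ω) (W ω) ht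

theorem measurable_logLikelihoodRate (hX : Measurable X) (hW : Measurable W) :
    StronglyMeasurable (Function.uncurry (logLikelihoodRate μ X W)) := by
  have := Measure.isProbabilityMeasure_map hX.aemeasurable (μ := μ)
  have hg : Measurable (fun p : ℝ × Ω => (invNoise p.1, invNoise p.1 • X p.2 + W p.2)) := by
    have := measurable_invNoise
    fun_prop
  have h1 := (stronglyMeasurable_posteriorMean_uncurry (μ.map X) (h := fun u => ‖u‖ ^ 2)
    (by fun_prop)).comp_measurable hg
  have h2 := (stronglyMeasurable_posteriorMean_uncurry (μ.map X) (h := id)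
    (by fun_prop)).comp_measurable hg
  have h3 : Measurable (fun p : ℝ × Ω => (2 * p.1)⁻¹) := by fun_prop
  exact h3.stronglyMeasurable.mul
    (h1.sub (h2.inner (hW.comp measurable_snd).stronglyMeasurable))

theorem integrable_logLikelihoodRate (hX : Measurable X) (hW : Measurable W)
    (hWlaw : μ.map W = stdGaussian F) (hXW : IndepFun X W μ) (t : ℝ) :
    Integrable (logLikelihoodRate μ X W t) μ :=
  ((integrable_posteriorMean_norm_sq hX hW hWlaw hXW _).sub
    ((memLp_two_posteriorMean hX hW hWlaw hXW _).integrable_inner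
      (memLp_two_noise hW hWlaw))).const_mul _

theorem integral_logLikelihoodRate (hX : Measurable X) (hW : Measurable W)
    (hWlaw : μ.map W = stdGaussian F) (hXW : IndepFun X W μ) (t : ℝ) :
    ∫ ω, logLikelihoodRate μ X W t ω ∂μ =
      (2 * t)⁻¹ * ((∫ w, ‖w‖ ^ 2 ∂stdGaussian F) - noiseEstimateEnergy μ X W (invNoise t)) := by
  simp only [logLikelihoodRate]
  rw [integral_const_mul, integral_sub (integrable_posteriorMean_norm_sq hX hW hWlaw hXW _)
    ((memLp_two_posteriorMean hX hW hWlaw hXW _).integrable_inner (memLp_two_noise hW hWlaw)),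
    integral_posteriorMean_norm_sq hX hW hWlaw hXW,
    integral_inner_posteriorMean_noise hX hW hWlaw hXW]

/-- A bound uniform over t ≥ a > 0, which yields integrability on time × Ω. -/
theorem integral_norm_logLikelihoodRate_le (hX : Measurable X) (hW : Measurable W)
    (hWlaw : μ.map W = stdGaussian F) (hXW : IndepFun X W μ) {t : ℝ} (ht : 0 < t) :
    ∫ ω, ‖logLikelihoodRate μ X W t ω‖ ∂μ ≤ (2 * t)⁻¹ * (2 * ∫ w, ‖w‖ ^ 2 ∂stdGaussian F) := by
  have := Measure.isProbabilityMeasure_map hX.aemeasurable (μ := μ)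
  have hS := integrable_posteriorMean_norm_sq hX hW hWlaw hXW (invNoise t)
  have hI := (memLp_two_posteriorMean hX hW hWlaw hXW (invNoise t)).integrable_inner
    (memLp_two_noise hW hWlaw)
  have h0 := integral_abs_inner_le hX hW hWlaw hXW (invNoise t)
  have h1 := noiseEstimateEnergy_le hX hW hWlaw hXW (invNoise t)
  have ht' : 0 < (2 * t)⁻¹ := by positivity
  calc ∫ ω, ‖logLikelihoodRate μ X W t ω‖ ∂μ
      ≤ ∫ ω, (2 * t)⁻¹ * (posteriorMean (μ.map X) (invNoise t) (fun u => ‖u‖ ^ 2)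
          (invNoise t • X ω + W ω) + |inner ℝ (posteriorMean (μ.map X) (invNoise t) id
            (invNoise t • X ω + W ω)) (W ω)|) ∂μ := by
        refine integral_mono (integrable_logLikelihoodRate hX hW hWlaw hXW t).norm
          ((hS.add hI.abs).const_mul _) fun ω => ?_
        simp only [logLikelihoodRate, norm_mul, Real.norm_eq_abs, abs_of_pos ht']
        refine mul_le_mul_of_nonneg_left ((abs_sub _ _).trans ?_) ht'.le
        rw [abs_of_nonneg (posteriorMean_norm_sq_nonneg _ _ _)]
    _ ≤ _ := by
        rw [integral_const_mul, integral_add hS hI.abs,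
          integral_posteriorMean_norm_sq hX hW hWlaw hXW]
        refine mul_le_mul_of_nonneg_left ?_ ht'.le
        linarith

theorem integrable_prod_logLikelihoodRate (hX : Measurable X) (hW : Measurable W)
    (hWlaw : μ.map W = stdGaussian F) (hXW : IndepFun X W μ) {a b : ℝ} (ha : 0 < a) :
    Integrable (Function.uncurry (logLikelihoodRate μ X W))
      ((volume.restrict (Set.Ioc a b)).prod μ) := by
  have hm := measurable_logLikelihoodRate (μ := μ) hX hW
  refine (integrable_prod_iff hm.aestronglyMeasurable).2
    ⟨.of_forall fun t => integrable_logLikelihoodRate hX hW hWlaw hXW t, ?_⟩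
  refine Integrable.of_bound (C := (2 * a)⁻¹ * (2 * ∫ w, ‖w‖ ^ 2 ∂stdGaussian F))
    hm.norm.integral_prod_right.aestronglyMeasurable ?_
  filter_upwards [ae_restrict_mem measurableSet_Ioc] with t ht
  have h0 : 0 ≤ ∫ w : F, ‖w‖ ^ 2 ∂stdGaussian F := integral_nonneg fun _ => by positivity
  rw [Real.norm_of_nonneg (integral_nonneg fun _ => norm_nonneg _)]
  refine (integral_norm_logLikelihoodRate_le hX hW hWlaw hXW (ha.trans ht.1)).trans ?_
  have := ht.1
  gcongr

theorem intervalIntegrable_noiseEstimateEnergy (hX : Measurable X) (hW : Measurable W)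
    (hWlaw : μ.map W = stdGaussian F) (hXW : IndepFun X W μ) {a b : ℝ} (ha : 0 < a)
    (hab : a ≤ b) : IntervalIntegrable (fun t => (2 * t)⁻¹ *
      ((∫ w, ‖w‖ ^ 2 ∂stdGaussian F) - noiseEstimateEnergy μ X W (invNoise t))) volume a b := by
  rw [intervalIntegrable_iff_integrableOn_Ioc_of_le hab]
  have h := (integrable_prod_logLikelihoodRate hX hW hWlaw hXW (b := b) ha).integral_prod_left
  simp only [Function.uncurry_apply_pair, integral_logLikelihoodRate hX hW hWlaw hXW] at h
  exact h

/-- The expected log-likelihood of the observation evolves according to the energy of the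
posterior mean of the noise. -/
theorem integral_logLikelihood_sub (hX : Measurable X) (hW : Measurable W)
    (hWlaw : μ.map W = stdGaussian F) (hXW : IndepFun X W μ) {a b : ℝ} (ha : 0 < a) (hab : a ≤ b)
    (hint : ∀ t, 0 < t → Integrable (logLikelihood μ X W (invNoise t)) μ) :
    (∫ ω, logLikelihood μ X W (invNoise b) ω ∂μ) - ∫ ω, logLikelihood μ X W (invNoise a) ω ∂μ =
      ∫ t in a..b, (2 * t)⁻¹ *
        ((∫ w, ‖w‖ ^ 2 ∂stdGaussian F) - noiseEstimateEnergy μ X W (invNoise t)) := by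
  have hI := integrable_prod_logLikelihoodRate hX hW hWlaw hXW (b := b) ha
  simp_rw [← integral_logLikelihoodRate hX hW hWlaw hXW]
  rw [← Set.uIoc_of_le hab] at hI
  -- After Fubini the claim reduces to the fundamental theorem of calculus for almost every ω.
  rw [intervalIntegral_integral_swap hI, ← integral_sub (hint b (ha.trans_le hab)) (hint a ha)]
  refine integral_congr_ae ?_
  filter_upwards [hI.prod_left_ae] with ω hω
  refine (intervalIntegral.integral_eq_sub_of_hasDerivAt
    (f := fun t => logLikelihood μ X W (invNoise t) ω) (fun t ht => ?_) ?_).symm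
  · rw [Set.uIcc_of_le hab] at ht
    exact hasDerivAt_logLikelihood hX ω (ha.trans_le ht.1)
  · rw [intervalIntegrable_iff]
    exact hω

end Evolution

/-! ### Comparison weights with Huber tails -/

section HuberBound

variable {F : Type*} [NormedAddCommGroup F]

/-- The Huber function: half of the squared norm in the ball of radius `R`, extended with linear
growth. -/
noncomputable def huber (R : ℝ) (z : F) : ℝ :=
  if ‖z‖ ≤ R then ‖z‖ ^ 2 / 2 else R * ‖z‖ - R ^ 2 / 2

/-- Quadratic in the noise w but only linear in the signal v, so a first moment of X suffices where
‖v + w‖² would need a second one. -/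
theorem huber_add_le {R : ℝ} (hR : 0 ≤ R) (v w : F) :
    huber R (v + w) ≤ ‖w‖ ^ 2 / 2 + R * ‖v‖ := by
  have h := norm_add_le v w
  have hv := norm_nonneg v
  have hw := norm_nonneg w
  have hz := norm_nonneg (v + w)
  unfold huber
  split_ifs with h1
  · rcases le_total ‖v + w‖ ‖w‖ with h2 | h2
    · nlinarith [mul_nonneg hR hv]
    · nlinarith [mul_nonneg hR hv]
  · nlinarith [sq_nonneg (‖w‖ - R), mul_le_mul_of_nonneg_left h hR]

theorem norm_sub_half_le_huber {R : ℝ} (hR : 1 ≤ R) (z : F) : ‖z‖ - 1 / 2 ≤ huber R z := by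
  unfold huber
  split_ifs with h1
  · nlinarith [sq_nonneg (‖z‖ - 1)]
  · nlinarith [mul_nonneg (sub_nonneg.2 hR) (sub_nonneg.2 (not_le.1 h1).le)]

variable [InnerProductSpace ℝ F] [FiniteDimensional ℝ F] [MeasurableSpace F] [BorelSpace F]

theorem measurable_huber (R : ℝ) : Measurable (huber R : F → ℝ) :=
  Measurable.ite (measurableSet_le measurable_norm measurable_const) (by fun_prop) (by fun_prop)

theorem integrable_gaussRef_of_volume {f : F → ℝ} (hf : Integrable f) :
    Integrable f (gaussRef F) := by
  obtain ⟨c, -, h⟩ := exists_gaussRef_eq_smul_volume F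
  rw [h]
  exact hf.smul_measure ENNReal.ofReal_ne_top

/-- The exponential beats (1 + ‖z‖)^n with n = dim F + 1, a power whose inverse is integrable. -/
theorem integrable_exp_neg_norm : Integrable (fun z : F => Real.exp (-‖z‖)) := by
  set n := Module.finrank ℝ F + 1 with hn
  have h := integrable_one_add_norm (E := F) (μ := volume) (r := (n : ℝ)) (by rw [hn]; push_cast; linarith)
  refine (h.const_mul (Real.exp 1 * n.factorial)).mono'
    (by fun_prop : Continuous fun z : F => Real.exp (-‖z‖)).aestronglyMeasurable
    (.of_forall fun z => ?_)
  have hz : 0 ≤ 1 + ‖z‖ := by positivity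
  have hz' : 0 < (1 + ‖z‖) ^ n := by positivity
  have h1 := Real.pow_div_factorial_le_exp (1 + ‖z‖) hz n
  rw [Real.norm_of_nonneg (Real.exp_pos _).le, Real.rpow_neg hz, Real.rpow_natCast]
  have h2 : Real.exp (-‖z‖) = Real.exp 1 * (Real.exp (1 + ‖z‖))⁻¹ := by
    rw [← Real.exp_neg, ← Real.exp_add]; ring_nf
  rw [h2, mul_assoc]
  refine mul_le_mul_of_nonneg_left ?_ (Real.exp_pos _).le
  have hf : (0 : ℝ) < n.factorial := by exact_mod_cast n.factorial_pos
  rw [div_le_iff₀ hf] at h1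
  rw [← div_eq_mul_inv, le_div_iff₀ hz', inv_mul_le_iff₀ (Real.exp_pos _)]
  exact h1

theorem integrable_exp_neg_huber {R : ℝ} (hR : 1 ≤ R) :
    Integrable (fun z : F => Real.exp (-huber R z)) (gaussRef F) := by
  refine integrable_gaussRef_of_volume ((integrable_exp_neg_norm.const_mul (Real.exp (1 / 2))).mono'
    (measurable_huber R).neg.exp.aestronglyMeasurable (.of_forall fun z => ?_))
  rw [Real.norm_of_nonneg (Real.exp_pos _).le, ← Real.exp_add, Real.exp_le_exp]
  linarith [norm_sub_half_le_huber hR z]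

theorem integral_gaussKernel_gaussRef : ∫ z, gaussKernel z ∂gaussRef F = 1 := by
  have h : ∫⁻ z, ENNReal.ofReal (gaussKernel z) ∂gaussRef F = 1 := by
    rw [← setLIntegral_univ, ← withDensity_apply _ MeasurableSet.univ,
      gaussRef_withDensity_gaussKernel, measure_univ]
  rw [integral_eq_lintegral_of_nonneg_ae (.of_forall fun z => (gaussKernel_pos z).le)
    continuous_gaussKernel.aestronglyMeasurable, h, ENNReal.toReal_one]

/-- At each z the integrand equals the Gaussian kernel as soon as n ≥ ‖z‖, and e^(1/2 - ‖z‖)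
dominates. -/
theorem tendsto_integral_exp_neg_huber :
    Filter.Tendsto (fun n : ℕ => ∫ z, Real.exp (-huber (n : ℝ) z) ∂gaussRef F) Filter.atTop
      (nhds 1) := by
  rw [← integral_gaussKernel_gaussRef (F := F)]
  refine tendsto_integral_filter_of_dominated_convergence
    (fun z => Real.exp (1 / 2) * Real.exp (-‖z‖))
    (.of_forall fun n => (measurable_huber _).neg.exp.aestronglyMeasurable) ?_
    (integrable_gaussRef_of_volume (integrable_exp_neg_norm.const_mul (Real.exp (1 / 2))))
    (.of_forall fun z => ?_)
  · filter_upwards [Filter.eventually_ge_atTop 1] with n hn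
    refine .of_forall fun z => ?_
    rw [Real.norm_of_nonneg (Real.exp_pos _).le, ← Real.exp_add, Real.exp_le_exp]
    linarith [norm_sub_half_le_huber (R := n) (by exact_mod_cast hn) z]
  · obtain ⟨k, hk⟩ := exists_nat_ge ‖z‖
    refine tendsto_const_nhds.congr' ?_
    filter_upwards [Filter.eventually_ge_atTop k] with n hn
    have : ‖z‖ ≤ (n : ℝ) := hk.trans (by exact_mod_cast hn)
    rw [huber, if_pos this, gaussKernel, neg_div]

end HuberBound

/-! ### Bounds on the log-likelihood and its limit under large noise -/

section LogLikelihood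

variable {F : Type*} [NormedAddCommGroup F] [InnerProductSpace ℝ F] [FiniteDimensional ℝ F]
  [MeasurableSpace F] [BorelSpace F]
  {Ω : Type*} [MeasurableSpace Ω] {μ : Measure Ω} [IsProbabilityMeasure μ] {X W : Ω → F}

theorem measurable_logLikelihood (hX : Measurable X) (hW : Measurable W) (s : ℝ) :
    Measurable (logLikelihood μ X W s) := by
  have := Measure.isProbabilityMeasure_map hX.aemeasurable (μ := μ)
  exact ((measurable_noisyDensity (μ.map X) s).comp
    (f := fun ω => s • X ω + W ω) (by fun_prop)).log

/-- Importance weighting: the density of the observation cancels the denominator. -/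
theorem integrable_div_noisyDensity (hX : Measurable X) (hW : Measurable W)
    (hWlaw : μ.map W = stdGaussian F) (hXW : IndepFun X W μ) (s : ℝ) {ρ : F → ℝ}
    (hρ : Integrable ρ (gaussRef F)) (hρm : Measurable ρ) :
    Integrable (fun ω => ρ (s • X ω + W ω) / noisyDensity (μ.map X) s (s • X ω + W ω)) μ ∧
    ∫ ω, ρ (s • X ω + W ω) / noisyDensity (μ.map X) s (s • X ω + W ω) ∂μ =
      ∫ z, ρ z ∂gaussRef F := by
  have := Measure.isProbabilityMeasure_map hX.aemeasurable (μ := μ)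
  have hm := measurable_noisyDensity (μ.map X) s
  have hY : Measurable (fun ω => s • X ω + W ω) := by fun_prop
  have hr : ∀ z, (ENNReal.ofReal (noisyDensity (μ.map X) s z)).toReal •
      (ρ z / noisyDensity (μ.map X) s z) = ρ z := fun z => by
    have h0 := noisyDensity_pos (μ.map X) s z
    rw [ENNReal.toReal_ofReal h0.le, smul_eq_mul]
    field_simp
  have hmeas := (hρm.div hm).aestronglyMeasurable (μ := μ.map (fun ω => s • X ω + W ω))
  constructor
  · have h1 : Integrable (fun z => ρ z / noisyDensity (μ.map X) s z)
        (μ.map (fun ω => s • X ω + W ω)) := by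
      rw [map_observation hX hW hWlaw hXW, integrable_withDensity_iff_integrable_smul'
        hm.ennreal_ofReal (.of_forall fun _ => ENNReal.ofReal_lt_top)]
      simpa only [hr] using hρ
    exact h1.comp_measurable hY
  · have h2 := integral_map hY.aemeasurable (μ := μ)
      (f := fun z => ρ z / noisyDensity (μ.map X) s z) hmeas
    rw [← h2, map_observation hX hW hWlaw hXW, integral_withDensity_eq_integral_toReal_smul
        hm.ennreal_ofReal (.of_forall fun _ => ENNReal.ofReal_lt_top)]
    simp only [hr]

/-- Pointwise Gibbs inequality: log u ≤ u - 1 with u the Huber weight divided by the density of the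
observation. -/
theorem neg_logLikelihood_le (hX : Measurable X) {s R : ℝ} (hs : 0 ≤ s) (hR : 0 ≤ R) (ω : Ω) :
    -logLikelihood μ X W s ω ≤ ‖W ω‖ ^ 2 / 2 + R * s * ‖X ω‖ +
      Real.exp (-huber R (s • X ω + W ω)) / noisyDensity (μ.map X) s (s • X ω + W ω) - 1 := by
  have := Measure.isProbabilityMeasure_map hX.aemeasurable (μ := μ)
  have h0 := noisyDensity_pos (μ.map X) s (s • X ω + W ω)
  have h1 := Real.log_le_sub_one_of_pos (div_pos (Real.exp_pos (-huber R (s • X ω + W ω))) h0)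
  rw [Real.log_div (Real.exp_pos _).ne' h0.ne', Real.log_exp] at h1
  have h2 := huber_add_le hR (s • X ω) (W ω)
  rw [norm_smul, Real.norm_of_nonneg hs, ← mul_assoc] at h2
  rw [logLikelihood]
  linarith

theorem logLikelihood_nonpos (hX : Measurable X) (s : ℝ) (ω : Ω) :
    logLikelihood μ X W s ω ≤ 0 := by
  have := Measure.isProbabilityMeasure_map hX.aemeasurable (μ := μ)
  exact Real.log_nonpos (noisyDensity_pos _ _ _).le (noisyDensity_le_one _ _ _)

theorem integrable_logLikelihood (hX : Measurable X) (hXint : Integrable X μ) (hW : Measurable W)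
    (hWlaw : μ.map W = stdGaussian F) (hXW : IndepFun X W μ) {s : ℝ} (hs : 0 ≤ s) :
    Integrable (logLikelihood μ X W s) μ := by
  have h1 := (integrable_div_noisyDensity hX hW hWlaw hXW s
    (integrable_exp_neg_huber le_rfl) (measurable_huber 1).neg.exp).1
  have h2 := (memLp_two_noise hW hWlaw).integrable_norm_pow two_ne_zero
  refine ((((h2.div_const 2).add (hXint.norm.const_mul (1 * s))).add h1).sub
    (integrable_const 1)).mono' (measurable_logLikelihood hX hW s).aestronglyMeasurable
    (.of_forall fun ω => ?_)
  rw [Real.norm_of_nonpos (logLikelihood_nonpos hX s ω)]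
  exact neg_logLikelihood_le hX hs zero_le_one ω

theorem neg_integral_logLikelihood_le (hX : Measurable X) (hXint : Integrable X μ)
    (hW : Measurable W) (hWlaw : μ.map W = stdGaussian F) (hXW : IndepFun X W μ) {s R : ℝ}
    (hs : 0 ≤ s) (hR : 1 ≤ R) :
    -∫ ω, logLikelihood μ X W s ω ∂μ ≤ (∫ w, ‖w‖ ^ 2 ∂stdGaussian F) / 2 +
      R * s * ∫ ω, ‖X ω‖ ∂μ + (∫ z, Real.exp (-huber R z) ∂gaussRef F) - 1 := by
  obtain ⟨h1, h1'⟩ := integrable_div_noisyDensity hX hW hWlaw hXW s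
    (integrable_exp_neg_huber hR) (measurable_huber R).neg.exp
  have h2 := ((memLp_two_noise hW hWlaw).integrable_norm_pow two_ne_zero).div_const 2
  have h3 := hXint.norm.const_mul (R * s)
  have h4 : Integrable (fun ω => ‖W ω‖ ^ 2 / 2 + R * s * ‖X ω‖) μ := h2.add h3
  have h5 : Integrable (fun ω => ‖W ω‖ ^ 2 / 2 + R * s * ‖X ω‖ +
      Real.exp (-huber R (s • X ω + W ω)) / noisyDensity (μ.map X) s (s • X ω + W ω)) μ :=
    h4.add h1
  rw [← integral_norm_sq_noise hW hWlaw, ← integral_neg]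
  refine (integral_mono (integrable_logLikelihood hX hXint hW hWlaw hXW hs).neg
    (h5.sub (integrable_const 1))
    fun ω => neg_logLikelihood_le hX hs (zero_le_one.trans hR) ω).trans_eq ?_
  rw [integral_sub' h5 (integrable_const 1), integral_add h4 h1, integral_add h2 h3, h1',
    integral_div, integral_const_mul]
  simp

/-- Conditionally on X = x, the Gaussian density of W cancels the denominator and leaves the total
mass of a translated probability density. -/
theorem lintegral_noisyDensity_div_gaussKernel (hX : Measurable X) (hW : Measurable W)
    (hWlaw : μ.map W = stdGaussian F) (hXW : IndepFun X W μ) (s : ℝ) :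
    ∫⁻ ω, ENNReal.ofReal (noisyDensity (μ.map X) s (s • X ω + W ω) / gaussKernel (W ω)) ∂μ
      = 1 := by
  have := Measure.isProbabilityMeasure_map hX.aemeasurable (μ := μ)
  have hm := measurable_noisyDensity (μ.map X) s
  have hg : Measurable (gaussKernel : F → ℝ) := continuous_gaussKernel.measurable
  have hf : Measurable (fun p : F × F =>
      ENNReal.ofReal (noisyDensity (μ.map X) s (s • p.1 + p.2) / gaussKernel p.2)) := by
    refine Measurable.ennreal_ofReal (Measurable.div (hm.comp (by fun_prop)) (hg.comp (by fun_prop)))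
  have h1 : ∫⁻ ω, ENNReal.ofReal (noisyDensity (μ.map X) s (s • X ω + W ω) / gaussKernel (W ω)) ∂μ
      = ∫⁻ p, ENNReal.ofReal (noisyDensity (μ.map X) s (s • p.1 + p.2) / gaussKernel p.2)
        ∂(μ.map (fun ω => (X ω, W ω))) := by
    rw [lintegral_map hf (by fun_prop)]
  rw [h1, (indepFun_iff_map_prod_eq_prod_map_map hX.aemeasurable hW.aemeasurable).1 hXW, hWlaw,
    lintegral_prod _ hf.aemeasurable]
  have hdens : ∫⁻ z, ENNReal.ofReal (noisyDensity (μ.map X) s z) ∂gaussRef F = 1 := by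
    have := Measure.isProbabilityMeasure_map (μ := μ) (f := fun ω => s • X ω + W ω) (by fun_prop)
    rw [← setLIntegral_univ, ← withDensity_apply _ MeasurableSet.univ,
      ← map_observation hX hW hWlaw hXW, measure_univ]
  have h2 : ∀ x : F, ∫⁻ w, ENNReal.ofReal (noisyDensity (μ.map X) s (s • x + w) / gaussKernel w)
      ∂stdGaussian F = 1 := fun x => by
    have hx : Measurable (fun w => ENNReal.ofReal
      (noisyDensity (μ.map X) s (s • x + w) / gaussKernel w)) :=
      ((hm.comp (f := fun w => s • x + w) (by fun_prop)).div hg).ennreal_ofReal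
    rw [← gaussRef_withDensity_gaussKernel,
      lintegral_withDensity_eq_lintegral_mul _ measurable_ofReal_gaussKernel hx, ← hdens,
      ← lintegral_add_left_eq_self (μ := gaussRef F)
        (fun z => ENNReal.ofReal (noisyDensity (μ.map X) s z)) (s • x)]
    refine lintegral_congr fun w => ?_
    have := gaussKernel_pos w
    rw [Pi.mul_apply, ← ENNReal.ofReal_mul this.le]
    congr 1
    field_simp
  simp [h2]

/-- Gibbs' inequality again, with u = m_s(sX + W)/g(W), where g is the kernel: adding an independent
signal cannot lower the entropy of the noise. -/
theorem le_neg_integral_logLikelihood (hX : Measurable X) (hXint : Integrable X μ)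
    (hW : Measurable W) (hWlaw : μ.map W = stdGaussian F) (hXW : IndepFun X W μ) {s : ℝ}
    (hs : 0 ≤ s) :
    (∫ w, ‖w‖ ^ 2 ∂stdGaussian F) / 2 ≤ -∫ ω, logLikelihood μ X W s ω ∂μ := by
  have := Measure.isProbabilityMeasure_map hX.aemeasurable (μ := μ)
  have h1 := lintegral_noisyDensity_div_gaussKernel hX hW hWlaw hXW s
  have hpos : ∀ ω, 0 < noisyDensity (μ.map X) s (s • X ω + W ω) / gaussKernel (W ω) :=
    fun ω => div_pos (noisyDensity_pos _ _ _) (gaussKernel_pos _)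
  have hmeas : Measurable
      (fun ω => noisyDensity (μ.map X) s (s • X ω + W ω) / gaussKernel (W ω)) :=
    ((measurable_noisyDensity (μ.map X) s).comp (by fun_prop)).div
      (continuous_gaussKernel.measurable.comp hW)
  have hint : Integrable
      (fun ω => noisyDensity (μ.map X) s (s • X ω + W ω) / gaussKernel (W ω)) μ := by
    refine ⟨hmeas.aestronglyMeasurable, ?_⟩
    rw [hasFiniteIntegral_iff_ofReal (.of_forall fun ω => (hpos ω).le), h1]
    exact ENNReal.one_lt_top
  have hval : ∫ ω, noisyDensity (μ.map X) s (s • X ω + W ω) / gaussKernel (W ω) ∂μ = 1 := by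
    rw [integral_eq_lintegral_of_nonneg_ae (.of_forall fun ω => (hpos ω).le)
      hmeas.aestronglyMeasurable, h1, ENNReal.toReal_one]
  have h2 := ((memLp_two_noise hW hWlaw).integrable_norm_pow two_ne_zero).div_const 2
  have h3 := integrable_logLikelihood hX hXint hW hWlaw hXW hs
  have h4 : ∫ ω, (logLikelihood μ X W s ω + ‖W ω‖ ^ 2 / 2) ∂μ ≤
      ∫ ω, (noisyDensity (μ.map X) s (s • X ω + W ω) / gaussKernel (W ω) - 1) ∂μ := by
    refine integral_mono (h3.add h2) (hint.sub (integrable_const 1)) fun ω => ?_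
    have h5 := Real.log_le_sub_one_of_pos (hpos ω)
    rw [Real.log_div (noisyDensity_pos _ _ _).ne' (gaussKernel_pos _).ne', gaussKernel,
      Real.log_exp] at h5
    simp only [logLikelihood, gaussKernel]
    linarith
  rw [integral_add h3 h2, integral_sub hint (integrable_const 1), hval, integral_div,
    integral_norm_sq_noise hW hWlaw] at h4
  simp only [integral_const, probReal_univ, smul_eq_mul, mul_one, sub_self] at h4
  linarith

theorem tendsto_invNoise_atTop : Filter.Tendsto invNoise Filter.atTop (nhds 0) :=
  (Real.tendsto_sqrt_atTop.comp
    (Filter.tendsto_id.const_mul_atTop two_pos)).inv_tendsto_atTop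

/-- As the noise dominates, the expected log-likelihood approaches that of pure noise. -/
theorem tendsto_integral_logLikelihood (hX : Measurable X) (hXint : Integrable X μ)
    (hW : Measurable W) (hWlaw : μ.map W = stdGaussian F) (hXW : IndepFun X W μ) :
    Filter.Tendsto (fun t => ∫ ω, logLikelihood μ X W (invNoise t) ω ∂μ) Filter.atTop
      (nhds (-((∫ w, ‖w‖ ^ 2 ∂stdGaussian F) / 2))) := by
  set d := ∫ w, ‖w‖ ^ 2 ∂stdGaussian F
  refine Metric.tendsto_atTop.2 fun ε hε => ?_
  -- R is fixed first, so that the Huber weight has mass below 1 + ε/2; then T is taken so large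
  -- that R s E‖X‖ < ε/2.
  obtain ⟨n, hn⟩ := Filter.eventually_atTop.1
    ((tendsto_integral_exp_neg_huber (F := F)).eventually_lt_const
      (show (1 : ℝ) < 1 + ε / 2 by linarith))
  set R : ℝ := ((max n 1 : ℕ) : ℝ) with hR
  have hR1 : (1 : ℝ) ≤ R := by rw [hR]; exact_mod_cast le_max_right n 1
  have hRint := hn (max n 1) (le_max_left _ _)
  have h0 : Filter.Tendsto (fun t => R * invNoise t * ∫ ω, ‖X ω‖ ∂μ) Filter.atTop (nhds 0) := by
    simpa using (tendsto_invNoise_atTop.const_mul R).mul_const (∫ ω, ‖X ω‖ ∂μ)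
  obtain ⟨T, hT⟩ := Filter.eventually_atTop.1
    ((h0.eventually_lt_const (show 0 < ε / 2 by linarith)).and
      (Filter.eventually_gt_atTop 0))
  refine ⟨T, fun t ht => ?_⟩
  obtain ⟨h1, h2⟩ := hT t ht
  have h3 := neg_integral_logLikelihood_le hX hXint hW hWlaw hXW (invNoise_pos h2).le hR1
  have h4 := le_neg_integral_logLikelihood hX hXint hW hWlaw hXW (invNoise_pos h2).le
  rw [Real.dist_eq, abs_lt]
  constructor <;> linarith

end LogLikelihood

/-! ### Product densities and divergence through densities -/

section PiDensity

theorem lintegral_fin_prod_eq_prod {n : ℕ} {E : Fin n → Type*} [∀ i, MeasurableSpace (E i)]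
    (μ : ∀ i, Measure (E i)) [∀ i, SigmaFinite (μ i)] {f : ∀ i, E i → ℝ≥0∞}
    (hf : ∀ i, Measurable (f i)) :
    ∫⁻ x, ∏ i, f i (x i) ∂Measure.pi μ = ∏ i, ∫⁻ x, f i x ∂μ i := by
  induction n with
  | zero => simp
  | succ n ih =>
    have h := (measurePreserving_piFinSuccAbove μ 0).symm
    rw [← h.lintegral_comp_emb (MeasurableEquiv.measurableEmbedding _)]
    have h1 : ∀ p : E 0 × (∀ i : Fin n, E (Fin.succAbove 0 i)),
        ∏ i, f i ((MeasurableEquiv.piFinSuccAbove E 0).symm p i) =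
          f 0 p.1 * ∏ i : Fin n, f i.succ (p.2 i) := fun p => by
      rw [Fin.prod_univ_succ]
      rfl
    simp_rw [h1]
    have h2 : Measurable (fun y : ∀ i : Fin n, E (Fin.succAbove 0 i) =>
        ∏ i : Fin n, f i.succ (y i)) :=
      Finset.measurable_prod _ fun i _ => (hf i.succ).comp (measurable_pi_apply i)
    rw [lintegral_prod_mul (hf 0).aemeasurable h2.aemeasurable, Fin.prod_univ_succ]
    congr 1
    exact ih (fun i => μ i.succ) (fun i => hf i.succ)

theorem pi_withDensity {n : ℕ} {E : Fin n → Type*} [∀ i, MeasurableSpace (E i)]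
    (μ : ∀ i, Measure (E i)) [∀ i, SigmaFinite (μ i)] {f : ∀ i, E i → ℝ≥0∞}
    (hf : ∀ i, Measurable (f i)) [∀ i, SigmaFinite ((μ i).withDensity (f i))] :
    Measure.pi (fun i => (μ i).withDensity (f i)) =
      (Measure.pi μ).withDensity (fun x => ∏ i, f i (x i)) := by
  refine Measure.pi_eq fun s hs => ?_
  rw [withDensity_apply _ (MeasurableSet.univ_pi hs), Measure.restrict_pi_pi,
    lintegral_fin_prod_eq_prod _ hf]
  exact Finset.prod_congr rfl fun i _ => (withDensity_apply _ (hs i)).symm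

/-- The mass correction built into `klDiv` vanishes between probability measures. -/
theorem klDiv_withDensity_ofReal {α : Type*} [MeasurableSpace α] {P Q : Measure α}
    [IsProbabilityMeasure P] [IsProbabilityMeasure Q] {f : α → ℝ} (hf : Measurable f)
    (hf0 : ∀ x, 0 ≤ f x) (hP : P = Q.withDensity (fun x => ENNReal.ofReal (f x)))
    (hint : Integrable (fun x => Real.log (f x)) P) :
    klDiv P Q = ENNReal.ofReal (∫ x, Real.log (f x) ∂P) := by
  have hac : P ≪ Q := hP ▸ withDensity_absolutelyContinuous _ _
  have h1 : llr P Q =ᵐ[P] fun x => Real.log (f x) := by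
    have h2 : P.rnDeriv Q =ᵐ[Q] fun x => ENNReal.ofReal (f x) := by
      rw [hP]; exact Measure.rnDeriv_withDensity _ hf.ennreal_ofReal
    filter_upwards [hac.ae_le h2] with x hx
    rw [llr, hx, ENNReal.toReal_ofReal (hf0 x)]
  rw [klDiv_of_ac_of_integrable hac (hint.congr h1.symm), integral_congr_ae h1]
  simp

variable {N : ℕ} {E : Fin N → Type*} [∀ i, NormedAddCommGroup (E i)]
  [∀ i, InnerProductSpace ℝ (E i)] [∀ i, FiniteDimensional ℝ (E i)]
  [∀ i, MeasurableSpace (E i)] [∀ i, BorelSpace (E i)]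

/-- The squared ℓ² norm is a sum over components, so the characteristic function factorises. -/
theorem map_ofLp_stdGaussian :
    (stdGaussian (PiLp 2 E)).map (WithLp.ofLp) = Measure.pi (fun i => stdGaussian (E i)) := by
  have hp := Measure.isProbabilityMeasure_map (μ := stdGaussian (PiLp 2 E))
    (f := WithLp.ofLp) (by fun_prop)
  refine charFun_eq_pi_iff.1 fun t => ?_
  rw [Measure.map_map (by fun_prop) (by fun_prop)]
  have : (WithLp.toLp 2 ∘ WithLp.ofLp : PiLp 2 E → PiLp 2 E) = id := rfl
  rw [this, Measure.map_id]
  simp_rw [charFun_stdGaussian]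
  rw [← Complex.exp_sum, ← Complex.ofReal_pow, PiLp.norm_sq_eq_of_L2]
  congr 1
  push_cast
  rw [← Finset.sum_div, Finset.sum_neg_distrib]

theorem gaussKernel_toLp (z : ∀ i, E i) :
    gaussKernel (WithLp.toLp 2 z) = ∏ i, gaussKernel (z i) := by
  simp only [gaussKernel]
  rw [← Real.exp_sum, PiLp.norm_sq_eq_of_L2, ← Finset.sum_div, Finset.sum_neg_distrib]

theorem map_ofLp_gaussRef :
    (gaussRef (PiLp 2 E)).map (WithLp.ofLp) = Measure.pi (fun i => gaussRef (E i)) := by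
  have hm : ∀ i, Measurable (fun z : E i => ENNReal.ofReal (gaussKernel z)⁻¹) := fun i =>
    continuous_gaussKernel.measurable.inv.ennreal_ofReal
  have hm' : Measurable (fun z : PiLp 2 E => ENNReal.ofReal (gaussKernel z)⁻¹) :=
    continuous_gaussKernel.measurable.inv.ennreal_ofReal
  have : ∀ i, SigmaFinite ((stdGaussian (E i)).withDensity
      fun z => ENNReal.ofReal (gaussKernel z)⁻¹) := fun i =>
    inferInstanceAs (SigmaFinite (gaussRef (E i)))
  have hp : Measurable (fun x : ∀ i, E i => ∏ i, ENNReal.ofReal (gaussKernel (x i))⁻¹) :=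
    Finset.measurable_prod _ fun i _ => (hm i).comp (measurable_pi_apply i)
  simp only [gaussRef]
  rw [pi_withDensity _ hm, ← map_ofLp_stdGaussian]
  refine Measure.ext_of_lintegral _ fun f hf => ?_
  rw [lintegral_map hf (by fun_prop), lintegral_withDensity_eq_lintegral_mul _ hm' (by fun_prop),
    lintegral_withDensity_eq_lintegral_mul _ hp hf, lintegral_map (by fun_prop) (by fun_prop)]
  refine lintegral_congr fun z => ?_
  simp only [Pi.mul_apply]
  congr 1
  rw [← ENNReal.ofReal_prod_of_nonneg (fun i _ => (inv_pos.2 (gaussKernel_pos _)).le),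
    Finset.prod_inv_distrib, ← gaussKernel_toLp]

end PiDensity

/-! ### Component channels and total correlation of the observation -/

section ComponentChannels

variable {N : ℕ} {E : Fin N → Type*} [∀ i, NormedAddCommGroup (E i)]
  [∀ i, InnerProductSpace ℝ (E i)] [∀ i, FiniteDimensional ℝ (E i)]
  [∀ i, MeasurableSpace (E i)] [∀ i, BorelSpace (E i)]
  {Ω : Type*} [MeasurableSpace Ω] {μ : Measure Ω} [IsProbabilityMeasure μ] {X W : Ω → PiLp 2 E}

theorem measurable_component (hX : Measurable X) (i : Fin N) : Measurable (fun ω => X ω i) :=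
  (measurable_pi_apply i).comp ((WithLp.measurable_ofLp 2 _).comp hX)

theorem integrable_component (hX : Measurable X) (hXint : Integrable X μ) (i : Fin N) :
    Integrable (fun ω => X ω i) μ :=
  hXint.mono (measurable_component hX i).aestronglyMeasurable
    (.of_forall fun ω => PiLp.norm_apply_le (X ω) i)

theorem map_component_noise (hW : Measurable W) (hWlaw : μ.map W = stdGaussian (PiLp 2 E))
    (i : Fin N) : μ.map (fun ω => W ω i) = stdGaussian (E i) := by
  have h1 : μ.map (fun ω => W ω i) =
      ((μ.map W).map WithLp.ofLp).map (Function.eval i) := by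
    rw [Measure.map_map (by fun_prop) hW, Measure.map_map (measurable_pi_apply i) (by fun_prop)]
    rfl
  rw [h1, hWlaw, map_ofLp_stdGaussian, (measurePreserving_eval _ i).map_eq]

theorem indepFun_component (hXW : IndepFun X W μ) (i : Fin N) :
    IndepFun (fun ω => X ω i) (fun ω => W ω i) μ :=
  hXW.comp (φ := fun x : PiLp 2 E => x i) (ψ := fun x : PiLp 2 E => x i)
    (measurable_component measurable_id i) (measurable_component measurable_id i)

theorem noisyDensity_div_prod_pos (hX : Measurable X) (s : ℝ) (z : ∀ i, E i) :
    0 < noisyDensity (μ.map X) s (WithLp.toLp 2 z) /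
      ∏ i, noisyDensity (μ.map (fun ω => X ω i)) s (z i) := by
  have := Measure.isProbabilityMeasure_map hX.aemeasurable (μ := μ)
  refine div_pos (noisyDensity_pos _ _ _) (Finset.prod_pos fun i _ => ?_)
  have := Measure.isProbabilityMeasure_map (measurable_component hX i).aemeasurable (μ := μ)
  exact noisyDensity_pos _ _ _

/-- Both laws have densities against the product of the `gaussRef`s, and the quotient is legitimate
because the marginal densities are positive everywhere. -/
theorem map_observation_eq_withDensity (hX : Measurable X) (hW : Measurable W)
    (hWlaw : μ.map W = stdGaussian (PiLp 2 E)) (hXW : IndepFun X W μ) (s : ℝ) :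
    μ.map (fun ω i => (s • X ω + W ω) i) =
      (Measure.pi (fun i => μ.map (fun ω => (s • X ω + W ω) i))).withDensity
        (fun z => ENNReal.ofReal (noisyDensity (μ.map X) s (WithLp.toLp 2 z) /
          ∏ i, noisyDensity (μ.map (fun ω => X ω i)) s (z i))) := by
  have := Measure.isProbabilityMeasure_map hX.aemeasurable (μ := μ)
  have hpi : ∀ i, IsProbabilityMeasure (μ.map (fun ω => X ω i)) := fun i =>
    Measure.isProbabilityMeasure_map (measurable_component hX i).aemeasurable
  have hYi : ∀ i, Measurable (fun ω => s • X ω i + W ω i) := fun i =>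
    ((measurable_component hX i).const_smul s).add (measurable_component hW i)
  have hpi' : ∀ i, IsProbabilityMeasure (μ.map (fun ω => s • X ω i + W ω i)) := fun i =>
    Measure.isProbabilityMeasure_map (hYi i).aemeasurable
  have hm := measurable_noisyDensity (μ.map X) s
  have hmi : ∀ i, Measurable (noisyDensity (μ.map (fun ω => X ω i)) s) := fun i =>
    measurable_noisyDensity _ s
  have hlaw : ∀ i, μ.map (fun ω => s • X ω i + W ω i) = (gaussRef (E i)).withDensity
      (fun z => ENNReal.ofReal (noisyDensity (μ.map (fun ω => X ω i)) s z)) := fun i =>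
    map_observation (measurable_component hX i) (measurable_component hW i)
      (map_component_noise hW hWlaw i) (indepFun_component hXW i) s
  have hsf : ∀ i, SigmaFinite ((gaussRef (E i)).withDensity
      (fun z => ENNReal.ofReal (noisyDensity (μ.map (fun ω => X ω i)) s z))) := fun i => by
    rw [← hlaw i]; infer_instance
  have hprod : Measurable (fun z : ∀ i, E i =>
      ∏ i, noisyDensity (μ.map (fun ω => X ω i)) s (z i)) :=
    Finset.measurable_prod _ fun i _ => (hmi i).comp (measurable_pi_apply i)
  have hratio : Measurable (fun z : ∀ i, E i => noisyDensity (μ.map X) s (WithLp.toLp 2 z) /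
      ∏ i, noisyDensity (μ.map (fun ω => X ω i)) s (z i)) :=
    (hm.comp (f := WithLp.toLp 2) (by fun_prop)).div hprod
  have hprod' : Measurable (fun z : ∀ i, E i =>
      ∏ i, ENNReal.ofReal (noisyDensity (μ.map (fun ω => X ω i)) s (z i))) :=
    Finset.measurable_prod _ fun i _ => ((hmi i).comp (measurable_pi_apply i)).ennreal_ofReal
  simp only [PiLp.add_apply, PiLp.smul_apply]
  simp_rw [hlaw]
  rw [pi_withDensity _ (fun i => (hmi i).ennreal_ofReal), ← map_ofLp_gaussRef]
  have h1 : μ.map (fun ω i => s • X ω i + W ω i) =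
      (μ.map (fun ω => s • X ω + W ω)).map WithLp.ofLp := by
    rw [Measure.map_map (by fun_prop) (by fun_prop)]; rfl
  rw [h1, map_observation hX hW hWlaw hXW, ← withDensity_mul _ hprod' hratio.ennreal_ofReal]
  refine Measure.ext_of_lintegral _ fun f hf => ?_
  rw [lintegral_map hf (by fun_prop), lintegral_withDensity_eq_lintegral_mul _ hm.ennreal_ofReal
    (by fun_prop), lintegral_withDensity_eq_lintegral_mul _
      (hprod'.mul hratio.ennreal_ofReal) hf, lintegral_map
      ((hprod'.mul hratio.ennreal_ofReal).mul hf) (by fun_prop)]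
  refine lintegral_congr fun z => ?_
  simp only [Pi.mul_apply]
  congr 1
  have hpos : 0 < ∏ i, noisyDensity (μ.map (fun ω => X ω i)) s (z i) :=
    Finset.prod_pos fun i _ => noisyDensity_pos _ _ _
  rw [← ENNReal.ofReal_prod_of_nonneg (fun i _ => (noisyDensity_pos _ _ _).le),
    ← ENNReal.ofReal_mul hpos.le, mul_div_cancel₀ _ hpos.ne']

/-- The total correlation of the observation `s • X + W`, in terms of log-likelihoods. -/
theorem klDiv_observation (hX : Measurable X) (hXint : Integrable X μ) (hW : Measurable W)
    (hWlaw : μ.map W = stdGaussian (PiLp 2 E)) (hXW : IndepFun X W μ) {s : ℝ} (hs : 0 ≤ s) :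
    klDiv (μ.map (fun ω i => (s • X ω + W ω) i))
        (Measure.pi (fun i => μ.map (fun ω => (s • X ω + W ω) i))) =
      ENNReal.ofReal ((∫ ω, logLikelihood μ X W s ω ∂μ) -
        ∑ i, ∫ ω, logLikelihood μ (fun ω => X ω i) (fun ω => W ω i) s ω ∂μ) := by
  have := Measure.isProbabilityMeasure_map hX.aemeasurable (μ := μ)
  have hpi : ∀ i, IsProbabilityMeasure (μ.map (fun ω => X ω i)) := fun i =>
    Measure.isProbabilityMeasure_map (measurable_component hX i).aemeasurable
  have hYi : ∀ i, Measurable (fun ω => (s • X ω + W ω) i) := fun i =>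
    measurable_component (by fun_prop) i
  have hpi' : ∀ i, IsProbabilityMeasure (μ.map (fun ω => (s • X ω + W ω) i)) := fun i =>
    Measure.isProbabilityMeasure_map (hYi i).aemeasurable
  have hY : Measurable (fun ω i => (s • X ω + W ω) i) := measurable_pi_lambda _ hYi
  have hp := Measure.isProbabilityMeasure_map hY.aemeasurable (μ := μ)
  have hratio : Measurable (fun z : ∀ i, E i => noisyDensity (μ.map X) s (WithLp.toLp 2 z) /
      ∏ i, noisyDensity (μ.map (fun ω => X ω i)) s (z i)) :=
    ((measurable_noisyDensity (μ.map X) s).comp (f := WithLp.toLp 2) (by fun_prop)).div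
      (Finset.measurable_prod _ fun i _ => (measurable_noisyDensity
        (μ.map (fun ω => X ω i)) s).comp (measurable_pi_apply i))
  have hlog : ∀ ω, Real.log (noisyDensity (μ.map X) s (WithLp.toLp 2 fun i => (s • X ω + W ω) i) /
      ∏ i, noisyDensity (μ.map (fun ω => X ω i)) s ((s • X ω + W ω) i)) =
      logLikelihood μ X W s ω -
        ∑ i, logLikelihood μ (fun ω => X ω i) (fun ω => W ω i) s ω := fun ω => by
    rw [Real.log_div (noisyDensity_pos _ _ _).ne'
      (Finset.prod_pos fun i _ => noisyDensity_pos _ _ _).ne',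
      Real.log_prod fun i _ => (noisyDensity_pos _ _ _).ne']
    rfl
  have hint1 := integrable_logLikelihood hX hXint hW hWlaw hXW hs
  have hint2 : ∀ i, Integrable (logLikelihood μ (fun ω => X ω i) (fun ω => W ω i) s) μ := fun i =>
    integrable_logLikelihood (measurable_component hX i) (integrable_component hX hXint i)
      (measurable_component hW i) (map_component_noise hW hWlaw i) (indepFun_component hXW i) hs
  rw [klDiv_withDensity_ofReal hratio (fun z => (noisyDensity_div_prod_pos hX s z).le)
    (map_observation_eq_withDensity hX hW hWlaw hXW s)]
  · rw [integral_map hY.aemeasurable hratio.log.aestronglyMeasurable]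
    simp_rw [hlog]
    rw [integral_sub hint1 (integrable_finsetSum _ fun i _ => hint2 i),
      integral_finsetSum _ fun i _ => hint2 i]
  · rw [integrable_map_measure hratio.log.aestronglyMeasurable hY.aemeasurable]
    simp only [Function.comp_def, hlog]
    exact hint1.sub (integrable_finsetSum _ fun i _ => hint2 i)

/-- Additivity of the noise energy makes the constants cancel, both in the rate and in the limit t →
∞. -/
theorem integral_norm_sq_stdGaussian_piLp :
    ∫ w, ‖w‖ ^ 2 ∂stdGaussian (PiLp 2 E) = ∑ i, ∫ w, ‖w‖ ^ 2 ∂stdGaussian (E i) := by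
  have hlaw : (stdGaussian (PiLp 2 E)).map id = stdGaussian (PiLp 2 E) := Measure.map_id
  simp_rw [PiLp.norm_sq_eq_of_L2]
  rw [integral_finsetSum]
  · refine Finset.sum_congr rfl fun i _ => ?_
    exact integral_norm_sq_noise (μ := stdGaussian (PiLp 2 E)) (W := fun w => w i)
      (measurable_component measurable_id i) (map_component_noise measurable_id hlaw i)
  · intro i _
    exact (memLp_two_noise (μ := stdGaussian (PiLp 2 E)) (W := fun w => w i)
      (measurable_component measurable_id i)
      (map_component_noise measurable_id hlaw i)).integrable_norm_pow two_ne_zero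

end ComponentChannels

/-! ### Tweedie's formula and orthogonality of noise estimates -/

section Denoisers

/-- Allows conditioning on sX + W in place of X_t. -/
theorem comap_const_smul {Ω F : Type*} [NormedAddCommGroup F] [NormedSpace ℝ F]
    [MeasurableSpace F] [BorelSpace F] {c : ℝ} (hc : c ≠ 0) (f : Ω → F) :
    MeasurableSpace.comap (fun ω => c • f ω) inferInstance =
      MeasurableSpace.comap f inferInstance := by
  have h := (measurableEmbedding_const_smul₀ (G₀ := ℝ) (α := F) hc).comap_eq
  conv_rhs => rw [← h]
  rw [MeasurableSpace.comap_comp]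
  rfl

variable {F : Type*} [NormedAddCommGroup F] [InnerProductSpace ℝ F] [FiniteDimensional ℝ F]
  [MeasurableSpace F] [BorelSpace F]
  {Ω : Type*} [MeasurableSpace Ω] {μ : Measure Ω} [IsProbabilityMeasure μ]

theorem invNoise_smul_noised (X W : Ω → F) {t : ℝ} (ht : 0 < t) (ω : Ω) :
    invNoise t • noised X W t ω = invNoise t • X ω + W ω := by
  have : Real.sqrt (2 * t) ≠ 0 := (Real.sqrt_pos.2 (by positivity)).ne'
  rw [noised, smul_add, smul_smul, invNoise, inv_mul_cancel₀ this, one_smul]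

theorem comap_noised (X W : Ω → F) {t : ℝ} (ht : 0 < t) :
    MeasurableSpace.comap (noised X W t) inferInstance =
      MeasurableSpace.comap (fun ω => invNoise t • X ω + W ω) inferInstance := by
  rw [← comap_const_smul (invNoise_pos ht).ne' (noised X W t)]
  simp_rw [invNoise_smul_noised X W ht]

theorem measurable_noised {X W : Ω → F} (hX : Measurable X) (hW : Measurable W) (t : ℝ) :
    Measurable (noised X W t) :=
  hX.add (hW.const_smul _)

/-- Tweedie's formula: the denoiser subtracts from the observation the posterior mean of the
noise. -/
theorem condExp_signal_noised {X W : Ω → F} (hX : Measurable X) (hXint : Integrable X μ)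
    (hW : Measurable W) (hWlaw : μ.map W = stdGaussian F) (hXW : IndepFun X W μ) {t : ℝ}
    (ht : 0 < t) :
    μ[X | MeasurableSpace.comap (noised X W t) inferInstance] =ᵐ[μ] fun ω => noised X W t ω -
      Real.sqrt (2 * t) • posteriorMean (μ.map X) (invNoise t) id (invNoise t • X ω + W ω) := by
  have hWint := (memLp_two_noise hW hWlaw).integrable one_le_two
  have hn := measurable_noised hX hW t
  have hX' : X = noised X W t - Real.sqrt (2 * t) • W := by
    funext ω; simp [noised]
  have hnint : Integrable (noised X W t) μ := hXint.add (hWint.smul _)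
  have h1 := condExp_comp_noise hX hW hWlaw hXW (invNoise t) continuous_id hWint
  rw [← comap_noised X W ht] at h1
  have h2 := condExp_sub hnint (hWint.smul (Real.sqrt (2 * t)))
    (MeasurableSpace.comap (noised X W t) inferInstance)
  have h3 := condExp_smul (μ := μ) (Real.sqrt (2 * t)) W
    (MeasurableSpace.comap (noised X W t) inferInstance)
  have h4 : μ[noised X W t | MeasurableSpace.comap (noised X W t) inferInstance] =
      noised X W t := condExp_of_stronglyMeasurable hn.comap_le
    (comap_measurable (noised X W t)).stronglyMeasurable hnint
  refine (condExp_congr_ae (.of_forall fun ω => congrFun hX' ω)).trans (h2.trans ?_)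
  filter_upwards [h1, h3] with ω h5 h6
  rw [Pi.sub_apply, h4, h6, Pi.smul_apply]
  exact congrArg (fun v => noised X W t ω - Real.sqrt (2 * t) • v) h5

variable {N : ℕ} {E : Fin N → Type*} [∀ i, NormedAddCommGroup (E i)]
  [∀ i, InnerProductSpace ℝ (E i)] [∀ i, FiniteDimensional ℝ (E i)]
  [∀ i, MeasurableSpace (E i)] [∀ i, BorelSpace (E i)] {X W : Ω → PiLp 2 E}

/-- The concatenation of the posterior means of the components of the noise, given the
corresponding components of the observation. -/
noncomputable def marginalNoiseEstimate (μ : Measure Ω) (X W : Ω → PiLp 2 E) (s : ℝ) (ω : Ω) :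
    PiLp 2 E :=
  WithLp.toLp 2 fun i => posteriorMean (μ.map (fun ω => X ω i)) s id (s • X ω i + W ω i)

theorem norm_sq_marginalNoiseEstimate (s : ℝ) (ω : Ω) :
    ‖marginalNoiseEstimate μ X W s ω‖ ^ 2 =
      ∑ i, ‖posteriorMean (μ.map (fun ω => X ω i)) s id (s • X ω i + W ω i)‖ ^ 2 :=
  PiLp.norm_sq_eq_of_L2 _ _

theorem stronglyMeasurable_comap_marginalNoiseEstimate (hX : Measurable X) (s : ℝ) :
    StronglyMeasurable[MeasurableSpace.comap (fun ω => s • X ω + W ω) inferInstance]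
      (marginalNoiseEstimate μ X W s) := by
  have hpi : ∀ i, IsProbabilityMeasure (μ.map (fun ω => X ω i)) := fun i =>
    Measure.isProbabilityMeasure_map (measurable_component hX i).aemeasurable
  have hΦ : Measurable (fun z : PiLp 2 E => WithLp.toLp 2 fun i =>
      posteriorMean (μ.map (fun ω => X ω i)) s id (z i)) := by
    have h1 : ∀ i, Measurable (fun z : PiLp 2 E =>
        posteriorMean (μ.map (fun ω => X ω i)) s id (z i)) := fun i => by
      have h2 := (stronglyMeasurable_posteriorMean (μ.map (fun ω => X ω i)) s
        (continuous_id (X := E i))).measurable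
      exact h2.comp (g := posteriorMean (μ.map (fun ω => X ω i)) s (id : E i → E i))
        (f := fun z : PiLp 2 E => z i) (measurable_component measurable_id i)
    exact (WithLp.measurable_toLp 2 _).comp (measurable_pi_lambda _ h1)
  have h3 : marginalNoiseEstimate μ X W s = fun ω => WithLp.toLp 2 fun i =>
      posteriorMean (μ.map (fun ω => X ω i)) s id ((s • X ω + W ω) i) := by
    funext ω
    simp only [marginalNoiseEstimate, PiLp.add_apply, PiLp.smul_apply]
  rw [h3]
  exact hΦ.stronglyMeasurable.comp_measurable (comap_measurable (fun ω => s • X ω + W ω))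

section

variable (hX : Measurable X) (hW : Measurable W)
  (hWlaw : μ.map W = stdGaussian (PiLp 2 E)) (hXW : IndepFun X W μ)

include hX hW hWlaw hXW

theorem memLp_two_posteriorMean_component (s : ℝ) (i : Fin N) :
    MemLp (fun ω => posteriorMean (μ.map (fun ω => X ω i)) s id (s • X ω i + W ω i)) 2 μ :=
  memLp_two_posteriorMean (measurable_component hX i) (measurable_component hW i)
    (map_component_noise hW hWlaw i) (indepFun_component hXW i) s

theorem memLp_two_marginalNoiseEstimate (s : ℝ) :
    MemLp (marginalNoiseEstimate μ X W s) 2 μ := by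
  have hY : Measurable (fun ω => s • X ω + W ω) := by fun_prop
  rw [memLp_two_iff_integrable_sq_norm
    ((stronglyMeasurable_comap_marginalNoiseEstimate hX s).mono hY.comap_le).aestronglyMeasurable]
  simp_rw [norm_sq_marginalNoiseEstimate]
  exact integrable_finsetSum _ fun i _ =>
    (memLp_two_posteriorMean_component hX hW hWlaw hXW s i).integrable_norm_pow two_ne_zero

/-- Pythagoras: the cross term E⟨U, V⟩ equals E‖U‖². -/
theorem integral_norm_sq_sub_marginalNoiseEstimate (s : ℝ) :
    ∫ ω, ‖posteriorMean (μ.map X) s id (s • X ω + W ω) - marginalNoiseEstimate μ X W s ω‖ ^ 2 ∂μ =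
      noiseEstimateEnergy μ X W s -
        ∑ i, noiseEstimateEnergy μ (fun ω => X ω i) (fun ω => W ω i) s := by
  have hV := memLp_two_posteriorMean hX hW hWlaw hXW s
  have hU := memLp_two_marginalNoiseEstimate hX hW hWlaw hXW s
  have hi := memLp_two_posteriorMean_component hX hW hWlaw hXW s
  have h1 : ∫ ω, ‖marginalNoiseEstimate μ X W s ω‖ ^ 2 ∂μ =
      ∑ i, noiseEstimateEnergy μ (fun ω => X ω i) (fun ω => W ω i) s := by
    simp_rw [norm_sq_marginalNoiseEstimate]
    rw [integral_finsetSum _ fun i _ => (hi i).integrable_norm_pow two_ne_zero]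
    rfl
  have h2 : ∫ ω, inner ℝ (marginalNoiseEstimate μ X W s ω)
        (posteriorMean (μ.map X) s id (s • X ω + W ω)) ∂μ =
      ∑ i, noiseEstimateEnergy μ (fun ω => X ω i) (fun ω => W ω i) s := by
    -- U depends on the joint observation only, so V may be traded for W; in each component W^i is
    -- then traded for its marginal estimate U^i.
    rw [← integral_inner_noise_of_comap hX hW hWlaw hXW s
      (stronglyMeasurable_comap_marginalNoiseEstimate hX s) hU]
    simp_rw [PiLp.inner_apply]
    rw [integral_finsetSum]
    · refine Finset.sum_congr rfl fun i _ => ?_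
      exact integral_inner_posteriorMean_noise (measurable_component hX i)
        (measurable_component hW i) (map_component_noise hW hWlaw i) (indepFun_component hXW i) s
    · intro i _
      exact (hi i).integrable_inner
        (memLp_two_noise (measurable_component hW i) (map_component_noise hW hWlaw i))
  have h3 : ∀ ω, ‖posteriorMean (μ.map X) s id (s • X ω + W ω) -
      marginalNoiseEstimate μ X W s ω‖ ^ 2 =
      ‖posteriorMean (μ.map X) s id (s • X ω + W ω)‖ ^ 2 -
        2 * inner ℝ (marginalNoiseEstimate μ X W s ω)
          (posteriorMean (μ.map X) s id (s • X ω + W ω)) +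
        ‖marginalNoiseEstimate μ X W s ω‖ ^ 2 := fun ω => by
    rw [norm_sub_sq_real, real_inner_comm]
  simp_rw [h3]
  have hVV := hV.integrable_norm_pow two_ne_zero
  have hUU := hU.integrable_norm_pow two_ne_zero
  have hUV := (hU.integrable_inner hV).const_mul 2
  have hVUV : Integrable (fun ω => ‖posteriorMean (μ.map X) s id (s • X ω + W ω)‖ ^ 2 -
      2 * inner ℝ (marginalNoiseEstimate μ X W s ω)
        (posteriorMean (μ.map X) s id (s • X ω + W ω))) μ := hVV.sub hUV
  rw [integral_add hVUV hUU, integral_sub hVV hUV, integral_const_mul, h1, h2,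
    noiseEstimateEnergy]
  ring

theorem sum_noiseEstimateEnergy_le (s : ℝ) :
    ∑ i, noiseEstimateEnergy μ (fun ω => X ω i) (fun ω => W ω i) s ≤
      noiseEstimateEnergy μ X W s := by
  rw [← sub_nonneg, ← integral_norm_sq_sub_marginalNoiseEstimate hX hW hWlaw hXW s]
  exact integral_nonneg fun _ => by positivity

/-- By Tweedie's formula X_t cancels in the difference of denoisers, which is -√(2t)(V - U); then
2t/(4t²) = 1/(2t). -/
theorem lintegral_denoisers_sub (hXint : Integrable X μ) {t : ℝ} (ht : 0 < t) :
    ENNReal.ofReal (1 / (4 * t ^ 2)) * ∫⁻ ω, ‖jointDenoiser μ X (noised X W t) ω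
        - marginalDenoisers μ X (noised X W t) ω‖ₑ ^ 2 ∂μ =
      ENNReal.ofReal ((2 * t)⁻¹ * (noiseEstimateEnergy μ X W (invNoise t) -
        ∑ i, noiseEstimateEnergy μ (fun ω => X ω i) (fun ω => W ω i) (invNoise t))) := by
  have hV := memLp_two_posteriorMean hX hW hWlaw hXW (invNoise t)
  have hU := memLp_two_marginalNoiseEstimate hX hW hWlaw hXW (invNoise t)
  have hi : ∀ᵐ ω ∂μ, ∀ i, (μ[(fun ω' => X ω' i) |
      MeasurableSpace.comap (fun ω' => noised X W t ω' i) inferInstance]) ω =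
      noised X W t ω i - Real.sqrt (2 * t) • posteriorMean (μ.map (fun ω => X ω i)) (invNoise t) id
        (invNoise t • X ω i + W ω i) :=
    ae_all_iff.2 fun i => condExp_signal_noised (measurable_component hX i)
      (integrable_component hX hXint i) (measurable_component hW i)
      (map_component_noise hW hWlaw i) (indepFun_component hXW i) ht
  have hdiff : ∀ᵐ ω ∂μ, ‖jointDenoiser μ X (noised X W t) ω
        - marginalDenoisers μ X (noised X W t) ω‖ₑ ^ 2 =
      ENNReal.ofReal (2 * t * ‖posteriorMean (μ.map X) (invNoise t) id
        (invNoise t • X ω + W ω) - marginalNoiseEstimate μ X W (invNoise t) ω‖ ^ 2) := by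
    filter_upwards [condExp_signal_noised hX hXint hW hWlaw hXW ht, hi] with ω h1 h2
    have h3 : jointDenoiser μ X (noised X W t) ω - marginalDenoisers μ X (noised X W t) ω =
        -(Real.sqrt (2 * t) • (posteriorMean (μ.map X) (invNoise t) id
          (invNoise t • X ω + W ω) - marginalNoiseEstimate μ X W (invNoise t) ω)) := by
      rw [jointDenoiser, h1]
      ext i
      simp only [marginalDenoisers, marginalNoiseEstimate, PiLp.sub_apply, PiLp.smul_apply,
        PiLp.neg_apply, h2 i, smul_sub]
      abel
    rw [h3, enorm_neg, ← ofReal_norm, ← ENNReal.ofReal_pow (norm_nonneg _), norm_smul, mul_pow,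
      Real.norm_of_nonneg (Real.sqrt_nonneg _), Real.sq_sqrt (by positivity)]
  have hint : Integrable (fun ω => 2 * t * ‖posteriorMean (μ.map X) (invNoise t) id
      (invNoise t • X ω + W ω) - marginalNoiseEstimate μ X W (invNoise t) ω‖ ^ 2) μ :=
    ((hV.sub hU).integrable_norm_pow two_ne_zero).const_mul (2 * t)
  rw [lintegral_congr_ae hdiff, ← ofReal_integral_eq_lintegral_ofReal hint
    (.of_forall fun ω => by positivity), integral_const_mul,
    ← ENNReal.ofReal_mul (by positivity)]
  congr 1
  rw [← integral_norm_sq_sub_marginalNoiseEstimate hX hW hWlaw hXW]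
  field_simp
  ring

end

end Denoisers

/-! ### Variational formula and lower semicontinuity of the divergence -/

section Variational

variable {α : Type*} [MeasurableSpace α] {P Q : Measure α} [IsProbabilityMeasure P]
  [IsProbabilityMeasure Q]

/-- Young's inequality for `klFun` and its convex conjugate b ↦ e^b - 1, with equality at b = log a.
-/
theorem mul_sub_exp_le_klFun {a : ℝ} (ha : 0 ≤ a) (b : ℝ) :
    a * b - (Real.exp b - 1) ≤ klFun a := by
  rcases ha.eq_or_lt with rfl | ha
  · simp only [klFun_zero]
    linarith [Real.exp_pos b]
  · have h1 := mul_le_mul_of_nonneg_left (Real.add_one_le_exp (b - Real.log a)) ha.le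
    rw [Real.exp_sub, Real.exp_log ha, mul_div_cancel₀ _ ha.ne'] at h1
    rw [klFun_apply]
    linarith

theorem integrable_of_abs_le {f : α → ℝ} (hf : Measurable f) {C : ℝ} (hC : ∀ x, |f x| ≤ C)
    (R : Measure α) [IsFiniteMeasure R] : Integrable f R :=
  Integrable.of_bound hf.aestronglyMeasurable C (.of_forall hC)

theorem integrable_exp_of_abs_le {f : α → ℝ} (hf : Measurable f) {C : ℝ} (hC : ∀ x, |f x| ≤ C)
    (R : Measure α) [IsFiniteMeasure R] : Integrable (fun x => Real.exp (f x)) R :=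
  Integrable.of_bound hf.exp.aestronglyMeasurable (Real.exp C) (.of_forall fun x => by
    rw [Real.norm_of_nonneg (Real.exp_pos _).le, Real.exp_le_exp]
    exact (le_abs_self _).trans (hC x))

theorem integrable_exp_sub_one_of_abs_le {f : α → ℝ} (hf : Measurable f) {C : ℝ}
    (hC : ∀ x, |f x| ≤ C) (R : Measure α) [IsFiniteMeasure R] :
    Integrable (fun x => Real.exp (f x) - 1) R :=
  (integrable_exp_of_abs_le hf hC R).sub (integrable_const 1)

theorem integrable_rnDeriv_mul {f : α → ℝ} (hf : Measurable f) {C : ℝ} (hC : ∀ x, |f x| ≤ C) :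
    Integrable (fun x => (P.rnDeriv Q x).toReal * f x) Q :=
  Measure.integrable_toReal_rnDeriv.mul_bdd (c := C) hf.aestronglyMeasurable (.of_forall hC)

theorem integral_sub_integral_exp (hPQ : P ≪ Q) {f : α → ℝ} (hf : Measurable f) {C : ℝ}
    (hC : ∀ x, |f x| ≤ C) :
    (∫ x, f x ∂P) - ∫ x, (Real.exp (f x) - 1) ∂Q =
      ∫ x, ((P.rnDeriv Q x).toReal * f x - (Real.exp (f x) - 1)) ∂Q := by
  rw [integral_sub (integrable_rnDeriv_mul hf hC)
    (integrable_exp_sub_one_of_abs_le hf hC Q), ← integral_rnDeriv_smul hPQ]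
  rfl

/-- Easy half of the variational formula. Using e^f - 1 instead of the logarithm of ∫ e^f keeps the
functional affine in each measure. -/
theorem ofReal_integral_sub_integral_exp_le_klDiv {f : α → ℝ} (hf : Measurable f) {C : ℝ}
    (hC : ∀ x, |f x| ≤ C) :
    ENNReal.ofReal ((∫ x, f x ∂P) - ∫ x, (Real.exp (f x) - 1) ∂Q) ≤ klDiv P Q := by
  by_cases h : klDiv P Q = ∞
  · rw [h]; exact le_top
  obtain ⟨hac, hint⟩ := klDiv_ne_top_iff.1 h
  rw [← ENNReal.ofReal_toReal h, toReal_klDiv_eq_integral_klFun hac,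
    integral_sub_integral_exp hac hf hC]
  refine ENNReal.ofReal_le_ofReal (integral_mono
    ((integrable_rnDeriv_mul hf hC).sub
      (integrable_exp_sub_one_of_abs_le hf hC Q))
    ((integrable_klFun_rnDeriv_iff hac).2 hint) fun x => ?_)
  exact mul_sub_exp_le_klFun ENNReal.toReal_nonneg _

/-- The logarithm truncated to `[-n, n]`, with value `-n` at `0`. -/
noncomputable def truncLog (n : ℕ) (a : ℝ) : ℝ :=
  if a = 0 then -n else max (-n) (min n (Real.log a))

theorem measurable_truncLog (n : ℕ) : Measurable (truncLog n) :=
  Measurable.ite (measurableSet_singleton 0) measurable_const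
    (measurable_const.max (measurable_const.min Real.measurable_log))

theorem abs_truncLog_le (n : ℕ) (a : ℝ) : |truncLog n a| ≤ n := by
  have hn : (0 : ℝ) ≤ n := n.cast_nonneg
  unfold truncLog
  split_ifs
  · simp
  · rw [abs_le]
    exact ⟨le_max_left _ _, max_le (by linarith) (min_le_left _ _)⟩

theorem tendsto_mul_truncLog {a : ℝ} (ha : 0 ≤ a) :
    Filter.Tendsto (fun n : ℕ => a * truncLog n a - (Real.exp (truncLog n a) - 1)) Filter.atTop
      (nhds (klFun a)) := by
  rcases ha.eq_or_lt with rfl | ha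
  · have h : Filter.Tendsto (fun n : ℕ => Real.exp (-(n : ℝ))) Filter.atTop (nhds 0) :=
      Real.tendsto_exp_neg_atTop_nhds_zero.comp tendsto_natCast_atTop_atTop
    simpa [truncLog, klFun_zero] using h.const_sub 1
  · obtain ⟨k, hk⟩ := exists_nat_ge |Real.log a|
    refine tendsto_const_nhds.congr' ?_
    filter_upwards [Filter.eventually_ge_atTop k] with n hn
    have h1 : |Real.log a| ≤ n := hk.trans (by exact_mod_cast hn)
    obtain ⟨h2, h3⟩ := abs_le.1 h1
    rw [truncLog, if_neg ha.ne', min_eq_right h3, max_eq_right h2, Real.exp_log ha, klFun_apply]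
    ring

/-- For a > 0 the truncation b lies between 0 and log a, where the concave function ab - (e^b - 1),
zero at b = 0, is nonnegative. This sign permits Fatou's lemma. -/
theorem mul_truncLog_nonneg {a : ℝ} (ha : 0 ≤ a) (n : ℕ) :
    0 ≤ a * truncLog n a - (Real.exp (truncLog n a) - 1) := by
  have hn : (0 : ℝ) ≤ n := n.cast_nonneg
  rcases ha.eq_or_lt with rfl | ha
  · simp [truncLog]
  · rw [truncLog, if_neg ha.ne']
    set b := max (-(n : ℝ)) (min n (Real.log a)) with hb
    have h0 : Real.exp b * (1 - b) ≤ 1 := by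
      have h := mul_le_mul_of_nonneg_left (Real.add_one_le_exp (-b)) (Real.exp_pos b).le
      rw [← Real.exp_add, add_neg_cancel, Real.exp_zero] at h
      linarith
    have h1 : 0 ≤ (a - Real.exp b) * b := by
      rcases le_total 0 (Real.log a) with h | h
      · have hb0 : 0 ≤ b := le_max_of_le_right (le_min hn h)
        have hb1 : b ≤ Real.log a := max_le (by linarith) (min_le_right _ _)
        have := (Real.le_log_iff_exp_le ha).1 hb1
        exact mul_nonneg (by linarith) hb0
      · have hb0 : b ≤ 0 := max_le (by linarith) ((min_le_right _ _).trans h)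
        have hb1 : Real.log a ≤ b := le_max_of_le_right (le_min (by linarith) le_rfl)
        have := (Real.log_le_iff_le_exp ha).1 hb1
        exact mul_nonneg_of_nonpos_of_nonpos (by linarith) hb0
    linarith

/-- Hard half: the truncated log-density is nearly optimal, by Fatou. -/
theorem exists_measurable_lt_of_lt_klDiv {c : ℝ≥0∞} (hc : c < klDiv P Q) :
    ∃ f : α → ℝ, Measurable f ∧ (∃ C, ∀ x, |f x| ≤ C) ∧
      c < ENNReal.ofReal ((∫ x, f x ∂P) - ∫ x, (Real.exp (f x) - 1) ∂Q) := by
  by_cases hac : P ≪ Q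
  · rw [klDiv_eq_lintegral_klFun_of_ac hac] at hc
    have ha : Measurable (fun x => (P.rnDeriv Q x).toReal) :=
      (Measure.measurable_rnDeriv P Q).ennreal_toReal
    set φ : ℕ → α → ℝ := fun n x => (P.rnDeriv Q x).toReal * truncLog n (P.rnDeriv Q x).toReal -
      (Real.exp (truncLog n (P.rnDeriv Q x).toReal) - 1) with hφ
    have hf : ∀ n, Measurable (fun x => truncLog n (P.rnDeriv Q x).toReal) := fun n =>
      (measurable_truncLog n).comp ha
    have hφm : ∀ n, Measurable (φ n) := fun n =>
      (ha.mul (hf n)).sub ((hf n).exp.sub measurable_const)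
    have h1 : ∫⁻ x, ENNReal.ofReal (klFun (P.rnDeriv Q x).toReal) ∂Q ≤
        Filter.liminf (fun n => ∫⁻ x, ENNReal.ofReal (φ n x) ∂Q) Filter.atTop := by
      refine le_trans (le_of_eq (lintegral_congr fun x => ?_))
        (lintegral_liminf_le fun n => (hφm n).ennreal_ofReal)
      exact (((ENNReal.continuous_ofReal.tendsto _).comp
        (tendsto_mul_truncLog ENNReal.toReal_nonneg)).liminf_eq).symm
    obtain ⟨n, hn⟩ := (Filter.eventually_lt_of_lt_liminf (hc.trans_le h1)).exists
    refine ⟨_, hf n, ⟨n, fun x => abs_truncLog_le n _⟩, hn.trans_eq ?_⟩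
    rw [integral_sub_integral_exp hac (hf n) (fun x => abs_truncLog_le n _),
      ofReal_integral_eq_lintegral_ofReal]
    · exact (integrable_rnDeriv_mul (hf n) (fun x => abs_truncLog_le n _)).sub
        (integrable_exp_sub_one_of_abs_le (hf n) (fun x => abs_truncLog_le n _) Q)
    · exact .of_forall fun x => mul_truncLog_nonneg ENNReal.toReal_nonneg n
  · rw [klDiv_of_not_ac hac] at hc
    have h1 : ∃ s, MeasurableSet s ∧ Q s = 0 ∧ P s ≠ 0 := by
      by_contra! h
      exact hac (Measure.AbsolutelyContinuous.mk fun s hs h0 => h s hs h0)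
    obtain ⟨s, hs, hQ, hP⟩ := h1
    -- Without absolute continuity, a multiple n of the indicator of a Q-null set charged by P costs
    -- nothing under Q and gains n P(s).
    have hP' : 0 < P.real s := ENNReal.toReal_pos hP (measure_ne_top _ _)
    obtain ⟨n, hn⟩ := exists_nat_gt (c.toReal / P.real s)
    refine ⟨s.indicator fun _ => (n : ℝ), measurable_const.indicator hs, ⟨n, fun x => ?_⟩, ?_⟩
    · by_cases hx : x ∈ s <;> simp [hx]
    · have h2 : ∫ x, (Real.exp (s.indicator (fun _ => (n : ℝ)) x) - 1) ∂Q = 0 := by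
        refine integral_eq_zero_of_ae ?_
        filter_upwards [measure_eq_zero_iff_ae_notMem.1 hQ] with x hx
        simp [hx]
      rw [h2, integral_indicator_const _ hs, sub_zero, smul_eq_mul, mul_comm,
        ENNReal.lt_ofReal_iff_toReal_lt hc.ne]
      exact (div_lt_iff₀ hP').1 hn

variable [TopologicalSpace α] [TopologicalSpace.PseudoMetrizableSpace α] [BorelSpace α]

/-- Bounded continuous functions are dense in L¹(P + Q), so one approximation serves both integrals.
-/
theorem exists_continuous_lt_of_lt_klDiv {c : ℝ≥0∞} (hc : c < klDiv P Q) :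
    ∃ f : α → ℝ, Continuous f ∧ (∃ C, ∀ x, |f x| ≤ C) ∧
      c < ENNReal.ofReal ((∫ x, f x ∂P) - ∫ x, (Real.exp (f x) - 1) ∂Q) := by
  obtain ⟨f, hf, ⟨C, hC⟩, hlt⟩ := exists_measurable_lt_of_lt_klDiv hc
  rw [ENNReal.lt_ofReal_iff_toReal_lt (hc.trans_le le_top).ne] at hlt
  set v := (∫ x, f x ∂P) - ∫ x, (Real.exp (f x) - 1) ∂Q with hv
  have hK : 0 < 1 + Real.exp C := by positivity
  -- The loss is at most ε under P and e^C ε under Q, together half of the available margin.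
  set ε := (v - c.toReal) / (2 * (1 + Real.exp C)) with hε
  have hε0 : 0 < ε := div_pos (by linarith) (by positivity)
  obtain ⟨g, hg, hgint⟩ :=
    (integrable_of_abs_le hf hC (P + Q)).exists_boundedContinuous_integral_sub_le hε0
  have hint := (integrable_of_abs_le hf hC (P + Q)).sub hgint
  have hdP : Integrable (fun x => ‖f x - g x‖) P :=
    (hint.mono_measure (Measure.le_add_right le_rfl)).norm
  have hdQ : Integrable (fun x => ‖f x - g x‖) Q :=
    (hint.mono_measure (Measure.le_add_left le_rfl)).norm
  rw [integral_add_measure hdP hdQ] at hg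
  have hP0 : 0 ≤ ∫ x, ‖f x - g x‖ ∂P := integral_nonneg fun _ => norm_nonneg _
  have hQ0 : 0 ≤ ∫ x, ‖f x - g x‖ ∂Q := integral_nonneg fun _ => norm_nonneg _
  -- Clamping is 1-Lipschitz and fixes f, so it preserves the approximation, while the bound C makes
  -- the exponential e^C-Lipschitz.
  set h : α → ℝ := fun x => max (-C) (min C (g x)) with hh
  have hcont : Continuous h := continuous_const.max (continuous_const.min g.continuous)
  have hCx : ∀ x : α, -C ≤ C := fun x => by
    have := abs_nonneg (f x); have := hC x; linarith
  have hhC : ∀ x, |h x| ≤ C := fun x =>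
    abs_le.2 ⟨le_max_left _ _, max_le (hCx x) (min_le_left _ _)⟩
  have hclose : ∀ x, |f x - h x| ≤ ‖f x - g x‖ := fun x => by
    obtain ⟨h1, h2⟩ := abs_le.1 (hC x)
    have h3 : f x = max (-C) (min C (f x)) := by rw [min_eq_right h2, max_eq_right h1]
    rw [Real.norm_eq_abs]
    conv_lhs => rw [h3]
    exact (abs_max_sub_max_le_max _ _ _ _).trans (max_le (by simp)
      ((abs_min_sub_min_le_max _ _ _ _).trans (max_le (by simp) le_rfl)))
  refine ⟨h, hcont, ⟨C, hhC⟩, ?_⟩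
  rw [ENNReal.lt_ofReal_iff_toReal_lt (hc.trans_le le_top).ne]
  have e1 : (∫ x, f x ∂P) - ∫ x, h x ∂P ≤ ∫ x, ‖f x - g x‖ ∂P := by
    rw [← integral_sub (integrable_of_abs_le hf hC P)
      (integrable_of_abs_le hcont.measurable hhC P)]
    exact integral_mono ((integrable_of_abs_le hf hC P).sub
      (integrable_of_abs_le hcont.measurable hhC P)) hdP
      fun x => (le_abs_self _).trans (hclose x)
  have e2 : (∫ x, (Real.exp (h x) - 1) ∂Q) - ∫ x, (Real.exp (f x) - 1) ∂Q ≤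
      Real.exp C * ∫ x, ‖f x - g x‖ ∂Q := by
    have i1 := integrable_exp_sub_one_of_abs_le hcont.measurable hhC Q
    have i2 := integrable_exp_sub_one_of_abs_le hf hC Q
    rw [← integral_sub i1 i2, ← integral_const_mul]
    refine integral_mono (i1.sub i2) (hdQ.const_mul _) fun x => ?_
    have h1 := mul_le_mul_of_nonneg_left (Real.add_one_le_exp (f x - h x)) (Real.exp_pos (h x)).le
    rw [← Real.exp_add, add_sub_cancel] at h1
    have h2 : Real.exp (h x) ≤ Real.exp C := Real.exp_le_exp.2 ((le_abs_self _).trans (hhC x))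
    have h3 := (neg_abs_le (f x - h x))
    have h4 := mul_le_mul h2 (hclose x) (abs_nonneg _) (Real.exp_pos C).le
    have h5 := mul_le_mul_of_nonneg_left h3 (Real.exp_pos (h x)).le
    linarith
  have h6 : (1 + Real.exp C) * ε = (v - c.toReal) / 2 := by
    rw [hε]; field_simp
  have h7 := Real.exp_pos C
  have h8 := mul_nonneg h7.le hP0
  have h9 := mul_le_mul_of_nonneg_left hg hK.le
  nlinarith

/-- The Kullback-Leibler divergence is lower semicontinuous for weak convergence. -/
theorem klDiv_le_of_tendsto {p q : ℕ → Measure α} [∀ n, IsProbabilityMeasure (p n)]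
    [∀ n, IsProbabilityMeasure (q n)] {K : ℝ≥0∞}
    (hp : ∀ f : α → ℝ, Continuous f → (∃ C, ∀ x, |f x| ≤ C) →
      Filter.Tendsto (fun n => ∫ x, f x ∂p n) Filter.atTop (nhds (∫ x, f x ∂P)))
    (hq : ∀ f : α → ℝ, Continuous f → (∃ C, ∀ x, |f x| ≤ C) →
      Filter.Tendsto (fun n => ∫ x, f x ∂q n) Filter.atTop (nhds (∫ x, f x ∂Q)))
    (hK : ∀ n, klDiv (p n) (q n) ≤ K) : klDiv P Q ≤ K := by
  by_contra! hlt
  -- A single f certifies the excess over K; its value passes to the limit, yet along the sequence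
  -- it never exceeds K.
  obtain ⟨f, hf, ⟨C, hC⟩, hlt'⟩ := exists_continuous_lt_of_lt_klDiv hlt
  have h1 := (hp f hf ⟨C, hC⟩).sub (hq (fun x => Real.exp (f x) - 1) (by fun_prop)
    ⟨Real.exp C + 1, fun x => by
      refine (abs_sub _ _).trans ?_
      rw [abs_of_pos (Real.exp_pos _), abs_one]
      have := Real.exp_le_exp.2 ((le_abs_self _).trans (hC x))
      linarith⟩)
  have h2 := (ENNReal.continuous_ofReal.tendsto _).comp h1
  refine hlt'.not_ge (le_of_tendsto' h2 fun n => ?_)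
  exact (ofReal_integral_sub_integral_exp_le_klDiv hf.measurable hC).trans (hK n)

end Variational

/-! ### Noise as a channel: data processing, small noise, rescaling -/

section NoisyLaw

theorem charFun_map_prod_add_smul {F : Type*} [NormedAddCommGroup F] [InnerProductSpace ℝ F]
    [FiniteDimensional ℝ F] [MeasurableSpace F] [BorelSpace F] (P Q : Measure F)
    [IsProbabilityMeasure P] [IsProbabilityMeasure Q] (c : ℝ) (u : F) :
    charFun ((P.prod Q).map (fun p => p.1 + c • p.2)) u = charFun P u * charFun Q (c • u) := by
  simp only [charFun_apply]
  rw [integral_map (by fun_prop) (by fun_prop), ← integral_prod_mul]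
  refine integral_congr_ae (.of_forall fun p => ?_)
  simp only [inner_add_left, inner_smul_left, inner_smul_right]
  rw [← Complex.exp_add]
  congr 1
  push_cast
  simp only [RCLike.conj_to_real]
  ring

variable {N : ℕ} {E : Fin N → Type*} [∀ i, NormedAddCommGroup (E i)]
  [∀ i, InnerProductSpace ℝ (E i)] [∀ i, FiniteDimensional ℝ (E i)]
  [∀ i, MeasurableSpace (E i)] [∀ i, BorelSpace (E i)]

/-- The law of `x + √(2t) w` where `x` has law `ν` and the components of `w` are independent
standard Gaussian vectors, independent of `x`. -/
noncomputable def noisyLaw (ν : Measure (∀ i, E i)) (t : ℝ) : Measure (∀ i, E i) :=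
  (ν.prod (Measure.pi fun i => stdGaussian (E i))).map (fun p => p.1 + Real.sqrt (2 * t) • p.2)

instance (ν : Measure (∀ i, E i)) [IsProbabilityMeasure ν] (t : ℝ) :
    IsProbabilityMeasure (noisyLaw ν t) :=
  Measure.isProbabilityMeasure_map (by fun_prop)

/-- All noise levels are coupled through the same pair (x, w), so dominated convergence applies. -/
theorem tendsto_integral_noisyLaw (ν : Measure (∀ i, E i)) [IsProbabilityMeasure ν] {t : ℕ → ℝ}
    (ht : Filter.Tendsto t Filter.atTop (nhds 0)) {f : (∀ i, E i) → ℝ} (hf : Continuous f)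
    (hC : ∃ C, ∀ x, |f x| ≤ C) :
    Filter.Tendsto (fun n => ∫ x, f x ∂noisyLaw ν (t n)) Filter.atTop (nhds (∫ x, f x ∂ν)) := by
  obtain ⟨C, hC⟩ := hC
  have h0 : ∫ x, f x ∂ν = ∫ p, f p.1 ∂(ν.prod (Measure.pi fun i => stdGaussian (E i))) := by
    rw [integral_fun_fst]; simp
  have h1 : ∀ n, ∫ x, f x ∂noisyLaw ν (t n) = ∫ p, f (p.1 + Real.sqrt (2 * t n) • p.2)
      ∂(ν.prod (Measure.pi fun i => stdGaussian (E i))) := fun n =>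
    integral_map (by fun_prop) hf.aestronglyMeasurable
  simp_rw [h1, h0]
  refine tendsto_integral_of_dominated_convergence (fun _ => C)
    (fun n => (hf.comp (by fun_prop)).aestronglyMeasurable) (integrable_const C)
    (fun n => .of_forall fun p => hC _) (.of_forall fun p => ?_)
  refine (hf.tendsto _).comp ?_
  have h2 : Filter.Tendsto (fun n => Real.sqrt (2 * t n)) Filter.atTop (nhds 0) := by
    simpa using ((ht.const_mul 2).sqrt)
  simpa using (h2.smul_const p.2).const_add p.1

/-- Adjoining the same independent noise to both laws leaves the divergence unchanged, and the
addition map can only decrease it. -/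
theorem klDiv_noisyLaw_le (P Q : Measure (∀ i, E i)) [IsProbabilityMeasure P]
    [IsProbabilityMeasure Q] (t : ℝ) : klDiv (noisyLaw P t) (noisyLaw Q t) ≤ klDiv P Q := by
  refine (klDiv_map_le _ _ (by fun_prop)).trans_eq ?_
  rw [← Measure.compProd_const, ← Measure.compProd_const, klDiv_compProd_left]

theorem noisyLaw_pi (P : ∀ i, Measure (E i)) [∀ i, IsProbabilityMeasure (P i)] (t : ℝ) :
    noisyLaw (Measure.pi P) t = Measure.pi fun i =>
      ((P i).prod (stdGaussian (E i))).map (fun p => p.1 + Real.sqrt (2 * t) • p.2) := by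
  have : ∀ i, IsProbabilityMeasure
      (((P i).prod (stdGaussian (E i))).map (fun p => p.1 + Real.sqrt (2 * t) • p.2)) := fun i =>
    Measure.isProbabilityMeasure_map (by fun_prop)
  have h1 := Measure.isProbabilityMeasure_map (μ := Measure.pi P)
    (f := WithLp.toLp 2) (by fun_prop)
  have h2 := Measure.isProbabilityMeasure_map (μ := Measure.pi fun i => stdGaussian (E i))
    (f := WithLp.toLp 2) (by fun_prop)
  refine charFun_eq_pi_iff.1 fun u => ?_
  have h3 : (noisyLaw (Measure.pi P) t).map (WithLp.toLp 2) =
      (((Measure.pi P).map (WithLp.toLp 2)).prod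
        ((Measure.pi fun i => stdGaussian (E i)).map (WithLp.toLp 2))).map
          (fun p => p.1 + Real.sqrt (2 * t) • p.2) := by
    rw [Measure.map_prod_map _ _ (by fun_prop) (by fun_prop), noisyLaw,
      Measure.map_map (by fun_prop) (by fun_prop), Measure.map_map (by fun_prop) (by fun_prop)]
    rfl
  rw [h3, charFun_map_prod_add_smul, charFun_pi, charFun_pi, ← Finset.prod_mul_distrib]
  simp_rw [charFun_map_prod_add_smul, PiLp.smul_apply]

variable {Ω : Type*} [MeasurableSpace Ω] {μ : Measure Ω} [IsProbabilityMeasure μ]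
  {X W : Ω → PiLp 2 E}

theorem map_noised_prod {F : Type*} [NormedAddCommGroup F] [InnerProductSpace ℝ F]
    [FiniteDimensional ℝ F] [MeasurableSpace F] [BorelSpace F] {X W : Ω → F}
    (hX : Measurable X) (hW : Measurable W) (hWlaw : μ.map W = stdGaussian F)
    (hXW : IndepFun X W μ) (t : ℝ) :
    μ.map (noised X W t) =
      ((μ.map X).prod (stdGaussian F)).map (fun p => p.1 + Real.sqrt (2 * t) • p.2) := by
  rw [← hWlaw, ← (indepFun_iff_map_prod_eq_prod_map_map hX.aemeasurable hW.aemeasurable).1 hXW,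
    Measure.map_map (by fun_prop) (by fun_prop)]
  rfl

section

variable (hX : Measurable X) (hW : Measurable W)
  (hWlaw : μ.map W = stdGaussian (PiLp 2 E)) (hXW : IndepFun X W μ)

include hX hW hWlaw hXW

/-- The noise acts on components independently and so keeps product laws product; both arguments of
the divergence pass through one channel. -/
theorem totalCorrelation_noised (t : ℝ) :
    totalCorrelation μ (noised X W t) =
      klDiv (noisyLaw (μ.map (fun ω i => X ω i)) t)
        (noisyLaw (Measure.pi fun i => μ.map (fun ω => X ω i)) t) := by
  have hpi : ∀ i, IsProbabilityMeasure (μ.map (fun ω => X ω i)) := fun i =>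
    Measure.isProbabilityMeasure_map (measurable_component hX i).aemeasurable
  have h1 : μ.map (fun ω i => noised X W t ω i) = noisyLaw (μ.map (fun ω i => X ω i)) t := by
    have h2 : (fun ω i => noised X W t ω i) = WithLp.ofLp ∘ noised X W t := rfl
    have h3 : (fun ω i => X ω i) = WithLp.ofLp ∘ X := rfl
    have := Measure.isProbabilityMeasure_map hX.aemeasurable (μ := μ)
    rw [h2, ← Measure.map_map (by fun_prop) (measurable_noised hX hW t),
      map_noised_prod hX hW hWlaw hXW, noisyLaw, h3, ← Measure.map_map (by fun_prop) hX,
      ← map_ofLp_stdGaussian, Measure.map_prod_map _ _ (by fun_prop) (by fun_prop),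
      Measure.map_map (by fun_prop) (by fun_prop), Measure.map_map (by fun_prop) (by fun_prop)]
    rfl
  rw [totalCorrelation, h1, noisyLaw_pi]
  congr 2
  funext i
  exact map_noised_prod (measurable_component hX i) (measurable_component hW i)
    (map_component_noise hW hWlaw i) (indepFun_component hXW i) t

theorem totalCorrelation_noised_le (t : ℝ) :
    totalCorrelation μ (noised X W t) ≤ totalCorrelation μ X := by
  have hpi : ∀ i, IsProbabilityMeasure (μ.map (fun ω => X ω i)) := fun i =>
    Measure.isProbabilityMeasure_map (measurable_component hX i).aemeasurable
  have h := Measure.isProbabilityMeasure_map (μ := μ) (f := fun ω i => X ω i) (by fun_prop)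
  rw [totalCorrelation_noised hX hW hWlaw hXW]
  exact klDiv_noisyLaw_le _ _ t

theorem totalCorrelation_le_of_noised {t : ℕ → ℝ}
    (ht : Filter.Tendsto t Filter.atTop (nhds 0)) {K : ℝ≥0∞}
    (hK : ∀ n, totalCorrelation μ (noised X W (t n)) ≤ K) : totalCorrelation μ X ≤ K := by
  have hpi : ∀ i, IsProbabilityMeasure (μ.map (fun ω => X ω i)) := fun i =>
    Measure.isProbabilityMeasure_map (measurable_component hX i).aemeasurable
  have h := Measure.isProbabilityMeasure_map (μ := μ) (f := fun ω i => X ω i) (by fun_prop)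
  refine klDiv_le_of_tendsto (fun f hf hC => tendsto_integral_noisyLaw _ ht hf hC)
    (fun f hf hC => tendsto_integral_noisyLaw _ ht hf hC) fun n => ?_
  rw [← totalCorrelation_noised hX hW hWlaw hXW]
  exact hK n

end

theorem totalCorrelation_const_smul_le {Z : Ω → PiLp 2 E} (hZ : Measurable Z) (c : ℝ) :
    totalCorrelation μ (fun ω => c • Z ω) ≤ totalCorrelation μ Z := by
  have hZi := measurable_component hZ
  have hpi : ∀ i, IsProbabilityMeasure (μ.map (fun ω => Z ω i)) := fun i =>
    Measure.isProbabilityMeasure_map (hZi i).aemeasurable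
  have hpi' : ∀ i, IsProbabilityMeasure ((μ.map (fun ω => Z ω i)).map (fun z => c • z)) :=
    fun i => Measure.isProbabilityMeasure_map (by fun_prop)
  have h := Measure.isProbabilityMeasure_map (μ := μ) (f := fun ω i => Z ω i) (by fun_prop)
  have h1 : μ.map (fun ω i => (c • Z ω) i) =
      (μ.map (fun ω i => Z ω i)).map (fun z i => c • z i) := by
    rw [Measure.map_map (by fun_prop) (by fun_prop)]
    rfl
  have h2 : Measure.pi (fun i => μ.map (fun ω => (c • Z ω) i)) =
      (Measure.pi fun i => μ.map (fun ω => Z ω i)).map (fun z i => c • z i) := by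
    rw [Measure.pi_map_pi (fun i => by fun_prop)]
    congr 1
    funext i
    rw [Measure.map_map (by fun_prop) (hZi i)]
    rfl
  rw [totalCorrelation, totalCorrelation, h1, h2]
  exact klDiv_map_le _ _ (by fun_prop)

theorem totalCorrelation_const_smul {Z : Ω → PiLp 2 E} (hZ : Measurable Z) {c : ℝ} (hc : c ≠ 0) :
    totalCorrelation μ (fun ω => c • Z ω) = totalCorrelation μ Z := by
  refine (totalCorrelation_const_smul_le hZ c).antisymm ?_
  have h := totalCorrelation_const_smul_le (μ := μ) (hZ.const_smul c) c⁻¹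
  have h1 : (fun ω => c⁻¹ • (c • Z) ω) = Z := by
    funext ω
    rw [Pi.smul_apply, smul_smul, inv_mul_cancel₀ hc, one_smul]
  rw [h1] at h
  exact h

end NoisyLaw

/-! ### Integrating the rate over time -/

section TotalCorrelation

theorem setLIntegral_Ioi_eq_iSup {f : ℝ → ℝ≥0∞} {u : ℕ → ℝ} {a : ℝ}
    (hu : Antitone u) (hlim : Filter.Tendsto u Filter.atTop (nhds a)) (ha : ∀ n, a < u n) :
    ∫⁻ t in Set.Ioi a, f t = ⨆ n, ∫⁻ t in Set.Ioi (u n), f t := by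
  have h : Set.Ioi a = ⋃ n, Set.Ioi (u n) := by
    ext x
    simp only [Set.mem_Ioi, Set.mem_iUnion]
    refine ⟨fun hx => (hlim.eventually_lt_const hx).exists, fun ⟨n, hn⟩ => (ha n).trans hn⟩
  have hmono : Monotone fun n => Set.Ioi (u n) := fun i j hij => Set.Ioi_subset_Ioi (hu hij)
  rw [h, setLIntegral_iUnion_of_directed _ hmono.directed_le]

/-- Monotone convergence along (a, a + n], where the integral is T(a) - T(a + n). -/
theorem setLIntegral_Ioi_ofReal {r T : ℝ → ℝ} {a : ℝ} (hr : ∀ t, a < t → 0 ≤ r t)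
    (hint : ∀ b, a ≤ b → IntervalIntegrable r volume a b)
    (hT : ∀ b, a ≤ b → T a - T b = ∫ t in a..b, r t)
    (hlim : Filter.Tendsto T Filter.atTop (nhds 0)) :
    ∫⁻ t in Set.Ioi a, ENNReal.ofReal (r t) = ENNReal.ofReal (T a) := by
  have hab : ∀ n : ℕ, a ≤ a + n := fun n => by linarith [n.cast_nonneg (α := ℝ)]
  have h1 : ∀ n : ℕ, ∫⁻ t in Set.Ioc a (a + n), ENNReal.ofReal (r t) =
      ENNReal.ofReal (T a - T (a + n)) := fun n => by
    rw [hT _ (hab n), intervalIntegral.integral_of_le (hab n), ofReal_integral_eq_lintegral_ofReal]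
    · exact (intervalIntegrable_iff_integrableOn_Ioc_of_le (hab n)).1 (hint _ (hab n))
    · filter_upwards [ae_restrict_mem measurableSet_Ioc] with t ht using hr t ht.1
  have hmono : Monotone (fun n : ℕ => Set.Ioc a (a + (n : ℝ))) := fun i j hij => by
    refine Set.Ioc_subset_Ioc_right ?_
    have : (i : ℝ) ≤ j := by exact_mod_cast hij
    linarith
  have h2 : Set.Ioi a = ⋃ n : ℕ, Set.Ioc a (a + (n : ℝ)) := by
    ext x
    simp only [Set.mem_Ioi, Set.mem_iUnion, Set.mem_Ioc]
    refine ⟨fun hx => ?_, fun ⟨n, hn⟩ => hn.1⟩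
    obtain ⟨n, hn⟩ := exists_nat_ge (x - a)
    exact ⟨n, hx, by linarith⟩
  have h3 : Filter.Tendsto (fun n : ℕ => ENNReal.ofReal (T a - T (a + n))) Filter.atTop
      (nhds (ENNReal.ofReal (T a))) := by
    have h4 : Filter.Tendsto (fun n : ℕ => T (a + n)) Filter.atTop (nhds 0) :=
      hlim.comp (Filter.tendsto_atTop_add_const_left _ _ tendsto_natCast_atTop_atTop)
    simpa [Function.comp_def] using
      (ENNReal.continuous_ofReal.tendsto _).comp (h4.const_sub (T a))
  rw [h2, setLIntegral_iUnion_of_directed _ hmono.directed_le]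
  refine tendsto_nhds_unique (tendsto_atTop_iSup fun i j hij => ?_) (by simpa only [h1] using h3)
  exact lintegral_mono_set (hmono hij)

variable {Ω : Type*} [MeasurableSpace Ω] {μ : Measure Ω} [IsProbabilityMeasure μ]
  {N : ℕ} {E : Fin N → Type*} [∀ i, NormedAddCommGroup (E i)]
  [∀ i, InnerProductSpace ℝ (E i)] [∀ i, FiniteDimensional ℝ (E i)]
  [∀ i, MeasurableSpace (E i)] [∀ i, BorelSpace (E i)] {X W : Ω → PiLp 2 E}

/-- The difference between the expected log-likelihood of the noisy observation at time `t` and the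
sum of those of its components. -/
noncomputable def logLikelihoodGap (μ : Measure Ω) (X W : Ω → PiLp 2 E) (t : ℝ) : ℝ :=
  (∫ ω, logLikelihood μ X W (invNoise t) ω ∂μ) -
    ∑ i, ∫ ω, logLikelihood μ (fun ω => X ω i) (fun ω => W ω i) (invNoise t) ω ∂μ

/-- The rate of decrease of the total correlation at time `t`. -/
noncomputable def energyGapRate (μ : Measure Ω) (X W : Ω → PiLp 2 E) (t : ℝ) : ℝ :=
  (2 * t)⁻¹ * (noiseEstimateEnergy μ X W (invNoise t) -
    ∑ i, noiseEstimateEnergy μ (fun ω => X ω i) (fun ω => W ω i) (invNoise t))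

/-- Inserting the noise energies, whose total is zero, exhibits the rate as a combination of
log-likelihood rates. -/
theorem energyGapRate_eq (t : ℝ) :
    energyGapRate μ X W t = (∑ i, (2 * t)⁻¹ * ((∫ w, ‖w‖ ^ 2 ∂stdGaussian (E i)) -
        noiseEstimateEnergy μ (fun ω => X ω i) (fun ω => W ω i) (invNoise t))) -
      (2 * t)⁻¹ * ((∫ w, ‖w‖ ^ 2 ∂stdGaussian (PiLp 2 E)) -
        noiseEstimateEnergy μ X W (invNoise t)) := by
  rw [integral_norm_sq_stdGaussian_piLp, ← Finset.mul_sum, Finset.sum_sub_distrib, energyGapRate]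
  ring

section

variable (hX : Measurable X) (hXint : Integrable X μ) (hW : Measurable W)
  (hWlaw : μ.map W = stdGaussian (PiLp 2 E)) (hXW : IndepFun X W μ)

include hX hXint hW hWlaw hXW

theorem totalCorrelation_noised_eq_ofReal {t : ℝ} (ht : 0 < t) :
    totalCorrelation μ (noised X W t) = ENNReal.ofReal (logLikelihoodGap μ X W t) := by
  rw [← totalCorrelation_const_smul (measurable_noised hX hW t) (invNoise_pos ht).ne',
    logLikelihoodGap, ← klDiv_observation hX hXint hW hWlaw hXW (invNoise_pos ht).le]
  simp_rw [invNoise_smul_noised X W ht]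
  rfl

theorem tendsto_logLikelihoodGap :
    Filter.Tendsto (logLikelihoodGap μ X W) Filter.atTop (nhds 0) := by
  have h1 := (tendsto_integral_logLikelihood hX hXint hW hWlaw hXW).sub
    (tendsto_finsetSum Finset.univ fun i _ =>
      tendsto_integral_logLikelihood (measurable_component hX i) (integrable_component hX hXint i)
        (measurable_component hW i) (map_component_noise hW hWlaw i) (indepFun_component hXW i))
  have h2 : -((∫ w, ‖w‖ ^ 2 ∂stdGaussian (PiLp 2 E)) / 2) -
      ∑ i, -((∫ w, ‖w‖ ^ 2 ∂stdGaussian (E i)) / 2) = 0 := by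
    rw [integral_norm_sq_stdGaussian_piLp, Finset.sum_neg_distrib, Finset.sum_div]
    ring
  rw [h2] at h1
  exact h1

theorem intervalIntegrable_component {a b : ℝ} (ha : 0 < a) (hab : a ≤ b) (i : Fin N) :
    IntervalIntegrable (fun t => (2 * t)⁻¹ * ((∫ w, ‖w‖ ^ 2 ∂stdGaussian (E i)) -
      noiseEstimateEnergy μ (fun ω => X ω i) (fun ω => W ω i) (invNoise t))) volume a b :=
  intervalIntegrable_noiseEstimateEnergy (measurable_component hX i) (measurable_component hW i)
    (map_component_noise hW hWlaw i) (indepFun_component hXW i) ha hab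

theorem intervalIntegrable_sum_component {a b : ℝ} (ha : 0 < a) (hab : a ≤ b) :
    IntervalIntegrable (fun t => ∑ i, (2 * t)⁻¹ * ((∫ w, ‖w‖ ^ 2 ∂stdGaussian (E i)) -
      noiseEstimateEnergy μ (fun ω => X ω i) (fun ω => W ω i) (invNoise t))) volume a b := by
  have h := IntervalIntegrable.sum Finset.univ fun i _ =>
    intervalIntegrable_component hX hXint hW hWlaw hXW ha hab i
  simpa only [Finset.sum_fn] using h

theorem intervalIntegrable_energyGapRate {a b : ℝ} (ha : 0 < a) (hab : a ≤ b) :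
    IntervalIntegrable (energyGapRate μ X W) volume a b := by
  have h1 := intervalIntegrable_sum_component hX hXint hW hWlaw hXW ha hab
  have h2 := intervalIntegrable_noiseEstimateEnergy hX hW hWlaw hXW ha hab
  rw [funext (energyGapRate_eq)]
  exact h1.sub h2

theorem logLikelihoodGap_sub {a b : ℝ} (ha : 0 < a) (hab : a ≤ b) :
    logLikelihoodGap μ X W a - logLikelihoodGap μ X W b = ∫ t in a..b, energyGapRate μ X W t := by
  have h1 := intervalIntegrable_component hX hXint hW hWlaw hXW ha hab
  have h2 := intervalIntegrable_noiseEstimateEnergy hX hW hWlaw hXW ha hab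
  have h3 := integral_logLikelihood_sub hX hW hWlaw hXW ha hab fun t ht =>
    integrable_logLikelihood hX hXint hW hWlaw hXW (invNoise_pos ht).le
  have h4 := fun i => integral_logLikelihood_sub (measurable_component hX i)
    (measurable_component hW i) (map_component_noise hW hWlaw i) (indepFun_component hXW i) ha hab
    fun t ht => integrable_logLikelihood (measurable_component hX i)
      (integrable_component hX hXint i) (measurable_component hW i)
      (map_component_noise hW hWlaw i) (indepFun_component hXW i) (invNoise_pos ht).le
  simp_rw [energyGapRate_eq]
  rw [intervalIntegral.integral_sub
    (intervalIntegrable_sum_component hX hXint hW hWlaw hXW ha hab) h2,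
    intervalIntegral.integral_finsetSum fun i _ => h1 i, ← h3]
  simp_rw [← h4]
  rw [Finset.sum_sub_distrib]
  simp only [logLikelihoodGap]
  ring

theorem setLIntegral_energyGapRate {a : ℝ} (ha : 0 < a) :
    ∫⁻ t in Set.Ioi a, ENNReal.ofReal (energyGapRate μ X W t) =
      totalCorrelation μ (noised X W a) := by
  rw [totalCorrelation_noised_eq_ofReal hX hXint hW hWlaw hXW ha]
  refine setLIntegral_Ioi_ofReal (fun t ht => ?_)
    (fun b hb => intervalIntegrable_energyGapRate hX hXint hW hWlaw hXW ha hb)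
    (fun b hb => logLikelihoodGap_sub hX hXint hW hWlaw hXW ha hb)
    (tendsto_logLikelihoodGap hX hXint hW hWlaw hXW)
  have ht0 : 0 < t := ha.trans ht
  exact mul_nonneg (by positivity)
    (sub_nonneg.2 (sum_noiseEstimateEnergy_le hX hW hWlaw hXW _))

end

end TotalCorrelation

/-! ### The identity, by letting the initial noise level tend to zero -/

theorem proposition2 {Ω : Type*} [MeasurableSpace Ω] (μ : Measure Ω) [IsProbabilityMeasure μ]
    {N : ℕ} {E : Fin N → Type*}
    [∀ i, NormedAddCommGroup (E i)] [∀ i, InnerProductSpace ℝ (E i)]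
    [∀ i, FiniteDimensional ℝ (E i)] [∀ i, MeasurableSpace (E i)] [∀ i, BorelSpace (E i)]
    (X W : Ω → PiLp 2 E)
    (hX : Measurable X) (hXint : Integrable X μ)
    (hW : Measurable W) (hWlaw : μ.map W = stdGaussian (PiLp 2 E))
    (hXW : IndepFun X W μ) :
    totalCorrelation μ X =
      ∫⁻ t in Set.Ioi (0 : ℝ), ENNReal.ofReal (1 / (4 * t ^ 2)) *
        ∫⁻ ω, ‖jointDenoiser μ X (noised X W t) ω
          - marginalDenoisers μ X (noised X W t) ω‖ₑ ^ 2 ∂μ := by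
  have h1 : ∫⁻ t in Set.Ioi (0 : ℝ), ENNReal.ofReal (1 / (4 * t ^ 2)) *
        ∫⁻ ω, ‖jointDenoiser μ X (noised X W t) ω
          - marginalDenoisers μ X (noised X W t) ω‖ₑ ^ 2 ∂μ =
      ∫⁻ t in Set.Ioi (0 : ℝ), ENNReal.ofReal (energyGapRate μ X W t) :=
    setLIntegral_congr_fun measurableSet_Ioi fun t ht =>
      lintegral_denoisers_sub hX hW hWlaw hXW hXint ht
  have hlim : Filter.Tendsto (fun n : ℕ => 1 / ((n : ℝ) + 1)) Filter.atTop (nhds 0) :=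
    tendsto_one_div_add_atTop_nhds_zero_nat
  have hpos : ∀ n : ℕ, 0 < 1 / ((n : ℝ) + 1) := fun n => by positivity
  have hanti : Antitone (fun n : ℕ => 1 / ((n : ℝ) + 1)) := fun m n hmn =>
    Nat.one_div_le_one_div hmn
  rw [h1, setLIntegral_Ioi_eq_iSup hanti hlim hpos]
  simp_rw [setLIntegral_energyGapRate hX hXint hW hWlaw hXW (hpos _)]
  -- The right side is now the supremum of T(X_a) over a = 1/(n+1). Data processing bounds it by
  -- T(X); lower semicontinuity bounds T(X) by it, infinite values included.
  refine le_antisymm ?_ (iSup_le fun n => totalCorrelation_noised_le hX hW hWlaw hXW _)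
  exact totalCorrelation_le_of_noised hX hW hWlaw hXW hlim fun n =>
    le_iSup (fun n : ℕ => totalCorrelation μ (noised X W (1 / ((n : ℝ) + 1)))) n
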